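/- **Setting.** For $\theta\in\mathbb R$ let $R_\theta=\begin{pmatrix}\cos\theta&-\sin\theta\\ \sin\theta&\cos\theta\end{pmatrix}$, and for integers $j\ge 1$, $0\le k\le 2^j-1$ let $$A_{j,k}=\begin{pmatrix}4^j&0\\0&2^j\end{pmatrix}R_{2\pi k/2^j},\qquad \varphi_{j,k,\lambda}(x)=8^{j/2}\,\varphi(A_{j,k}x-\lambda)\quad(x,\lambda\in\mathbb R^2).$$ The Fourier transform is $\hat f(\xi)=\int_{\mathbb R^2} f(x)e^{-2\pi i\,\xi\cdot x}\,dx$, extended to tempered distributions, and $\langle f,\varphi\rangle$ denotes $f(\overline{\varphi})$ for $f\in\mathcal S'(\mathbb R^2)$, $\varphi\in\mathcal S(\mathbb R^2)$. *Window.* Let $\varphi\in\mathcal S(\mathbb R^2)$ and $\varsigma>2$ be such that, for some $C\in\mathbb R$ and $\delta>0$, $$|\hat\varphi(\xi)|\le C\min(1,|\xi_1|^{\varsigma})\,e^{-\delta|\xi|^2}\qquad(\xi\in\mathbb R^2).$$ *Grid parameters.* Let $\Lambda\subset\mathbb R^2$ be a (full-rank) lattice, $L\in\mathbb R$ a constant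 (for example the diameter of a fundamental domain of $\Lambda$), $x_0\in\mathbb R^2$ and $\theta_0\in[0,2\pi)$. Let $k_j\in\{0,\dots,2^j-1\}$ and $\lambda_j\in\Lambda$ $(j\ge1)$ satisfy $$\frac{2\pi k_j}{2^j}\le 2\pi-\theta_0\le\frac{2\pi(k_j+1)}{2^j},\qquad |A_{j,k_j}x_0-\lambda_j|\le L .$$ *Microlocal Sobolev space.* Let $V_\varepsilon=\{\xi\in\mathbb R^2:|\xi_2|\le\varepsilon|\xi_1|\}$. For $s,M\ge0$, a distribution $f\in\mathcal S'(\mathbb R^2)$ belongs to $H^s_M(x_0,\theta_0)$ if there exist $\varepsilon>0$ and a smooth compactly supported function $\eta$ with $\eta\equiv1$ in a neighbourhood of $x_0$ such that $$\int_{R_{\theta_0}V_\varepsilon}|\widehat{\eta f}(\xi)|^2|\xi|^{2s}\,d\xi<\infty\quad\text{and}\quad\int_{\mathbb R^2}|\widehat{\eta f}(\xi)|^2(1+|\xi|)^{-2M}\,d\xi<\infty .$$ **Theorem.** Let $s,M\ge0$, let $\varphi,\varsigma,\Lambda,L,x_0,\theta_0,(k_j,\lambda_j)_{j\ge1}$ be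 as above, and assume $\varsigma>2s+2M-\tfrac12$. If $f\in H^s_M(x_0,\theta_0)$, then $$\sum_{j\ge1}\bigl|\langle f,\varphi_{j,k_j,\lambda_j}\rangle\bigr|^2\,4^{2js}<\infty .$$ In particular, there is a constant $C$ with $|\langle f,\varphi_{j,k_j,\lambda_j}\rangle|\le C\,4^{-js}$ for all $j\ge1$. -/

import Mathlib

open MeasureTheory SchwartzMap FourierTransform
open scoped Matrix ContDiff Topology

noncomputable section

namespace Wavepacket

/-- The Euclidean plane. -/
abbrev Plane : Type := EuclideanSpace ℝ (Fin 2)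

/-- The parabolic dilation `D_j = diag (4^j, 2^j)`. -/
def dilationMatrix (j : ℕ) : Matrix (Fin 2) (Fin 2) ℝ :=
  !![4 ^ j, 0; 0, 2 ^ j]

/-- The rotation `R_θ`. -/
def rotationMatrix (θ : ℝ) : Matrix (Fin 2) (Fin 2) ℝ :=
  !![Real.cos θ, -Real.sin θ; Real.sin θ, Real.cos θ]

/-- `A_{j,k} = D_j R_{2 k π / 2^j}`. -/
def parabolicMatrix (j k : ℕ) : Matrix (Fin 2) (Fin 2) ℝ :=
  dilationMatrix j * rotationMatrix (2 * k * Real.pi / 2 ^ j)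

theorem isUnit_det_parabolicMatrix (j k : ℕ) : IsUnit (parabolicMatrix j k).det := by
  rw [isUnit_iff_ne_zero, parabolicMatrix, Matrix.det_mul, dilationMatrix, rotationMatrix,
    Matrix.det_fin_two_of, Matrix.det_fin_two_of]
  have h : Real.cos (2 * k * Real.pi / 2 ^ j) * Real.cos (2 * k * Real.pi / 2 ^ j) -
      -Real.sin (2 * k * Real.pi / 2 ^ j) * Real.sin (2 * k * Real.pi / 2 ^ j) = 1 := by
    nlinarith [Real.sin_sq_add_cos_sq (2 * k * Real.pi / 2 ^ j)]
  rw [h]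
  simp

/-- `x ↦ A_{j,k} x` as a linear automorphism of the plane. -/
def parabolicEquiv (j k : ℕ) : Plane ≃L[ℝ] Plane :=
  (Matrix.toLinearEquiv (EuclideanSpace.basisFun (Fin 2) ℝ).toBasis (parabolicMatrix j k)
    (isUnit_det_parabolicMatrix j k)).toContinuousLinearEquiv

theorem parabolicEquiv_apply (j k : ℕ) (x : Plane) :
    parabolicEquiv j k x = Matrix.toEuclideanCLM (n := Fin 2) (𝕜 := ℝ) (parabolicMatrix j k) x := by
  rfl

/-- The wavepacket `φ_{j,k,λ}(x) = 8^{j/2} φ (A_{j,k} x - λ)`. -/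
def wavepacket (φ : 𝓢(Plane, ℂ)) (j k : ℕ) (lam : Plane) : 𝓢(Plane, ℂ) :=
  ((8 : ℝ) ^ ((j : ℝ) / 2)) •
    compCLMOfContinuousLinearEquiv ℝ (parabolicEquiv j k) (compSubConstCLM ℝ lam φ)

theorem wavepacket_apply (φ : 𝓢(Plane, ℂ)) (j k : ℕ) (lam x : Plane) :
    wavepacket φ j k lam x =
      ((8 : ℝ) ^ ((j : ℝ) / 2) : ℝ) *
        φ (Matrix.toEuclideanCLM (n := Fin 2) (𝕜 := ℝ) (parabolicMatrix j k) x - lam) := by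
  simp [wavepacket, parabolicEquiv_apply]

/-- The complex conjugate of a Schwartz function. -/
def conjSchwartz (φ : 𝓢(Plane, ℂ)) : 𝓢(Plane, ℂ) :=
  postcompCLM (𝕜 := ℝ) (Complex.conjCLE : ℂ →L[ℝ] ℂ) φ

theorem conjSchwartz_apply (φ : 𝓢(Plane, ℂ)) (x : Plane) :
    conjSchwartz φ x = starRingEnd ℂ (φ x) := by
  simp [conjSchwartz]

/-- The sesquilinear pairing `⟨f, φ⟩`, which is `∫ f φ̄` if `f` is a function. -/
def coeff (f : 𝓢'(Plane, ℂ)) (φ : 𝓢(Plane, ℂ)) : ℂ :=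
  f (conjSchwartz φ)

/-- The window condition `|φ̂(ξ)| ≤ C min (1, |ξ₁|^σ) exp (-δ |ξ|²)` for some `C` and `δ > 0`. -/
def WindowDecay (φ : 𝓢(Plane, ℂ)) (σ : ℝ) : Prop :=
  ∃ C δ : ℝ, 0 < δ ∧ ∀ ξ : Plane,
    ‖(𝓕 φ : 𝓢(Plane, ℂ)) ξ‖ ≤ C * min 1 (|ξ 0| ^ σ) * Real.exp (-δ * ‖ξ‖ ^ 2)

/-- The cone of width `ε` around the `ξ₁`-axis. -/
def cone (ε : ℝ) : Set Plane :=
  {ξ | |ξ 1| ≤ ε * |ξ 0|}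

/-- The rotated cone `R_θ V_ε`. -/
def rotatedCone (θ ε : ℝ) : Set Plane :=
  Matrix.toEuclideanCLM (n := Fin 2) (𝕜 := ℝ) (rotationMatrix θ) '' cone ε

/-- The Fourier transform of the tempered distribution `T` is the function `u`. -/
def HasFourierFunction (T : 𝓢'(Plane, ℂ)) (u : Plane → ℂ) : Prop :=
  ∀ g : 𝓢(Plane, ℂ), Integrable (fun ξ => g ξ * u ξ) ∧
    (𝓕 T : 𝓢'(Plane, ℂ)) g = ∫ ξ, g ξ * u ξ

/-- `f` belongs to the microlocal Sobolev space `H^s_M (x₀, θ₀)`. The product `η f` is compactly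
supported, so that its Fourier transform is a function `u`, unique almost everywhere. -/
def MemMicrolocalSobolev (s M : ℝ) (x₀ : Plane) (θ₀ : ℝ) (f : 𝓢'(Plane, ℂ)) : Prop :=
  ∃ (ε : ℝ) (η : Plane → ℂ) (u : Plane → ℂ),
    0 < ε ∧ ContDiff ℝ ∞ η ∧ HasCompactSupport η ∧ (∀ᶠ x in 𝓝 x₀, η x = 1) ∧
    HasFourierFunction (TemperedDistribution.smulLeftCLM ℂ η f) u ∧
    IntegrableOn (fun ξ => ‖u ξ‖ ^ 2 * ‖ξ‖ ^ (2 * s)) (rotatedCone θ₀ ε) ∧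
    Integrable (fun ξ => ‖u ξ‖ ^ 2 * (1 + ‖ξ‖) ^ (-2 * M))

/-- The sequences `(k_j)` and `(λ_j)`, `j ≥ 1`, are grid parameters related to `(x₀, θ₀)`, with
`L` the constant in the approximation of `x₀`. -/
structure IsGridParameters (Λ : Submodule ℤ Plane) (L : ℝ) (x₀ : Plane) (θ₀ : ℝ)
    (k : ℕ → ℕ) (lam : ℕ → Plane) : Prop where
  k_lt : ∀ j, 1 ≤ j → k j < 2 ^ j
  lam_mem : ∀ j, 1 ≤ j → lam j ∈ Λ
  angle_lower : ∀ j, 1 ≤ j → 2 * Real.pi * k j / 2 ^ j ≤ 2 * Real.pi - θ₀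
  angle_upper : ∀ j, 1 ≤ j → 2 * Real.pi - θ₀ ≤ 2 * Real.pi * (k j + 1) / 2 ^ j
  position : ∀ j, 1 ≤ j →
    ‖Matrix.toEuclideanCLM (n := Fin 2) (𝕜 := ℝ) (parabolicMatrix j (k j)) x₀ - lam j‖ ≤ L

end Wavepacket

end

/-!
The distribution is split as `f = η f + (1 - η) f`, with `η` the cutoff of the microlocal Sobolev
condition.

The part `(1 - η) f` vanishes near `x₀`, whereas the wavepackets in question are centred within
`L` of `x₀` in the parabolic coordinates; since the parabolic matrix expands by at least `2 ^ j`,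
every Schwartz seminorm of `(1 - η)` times such a wavepacket decays faster than any power of
`2 ^ j` (`exists_norm_apply_smulLeftCLM_wavepacket_le`).

The part `η f` has as Fourier transform a function `u`, and its coefficient is at most
`8 ^ (-j/2) ∫ |u ξ| |φ̂ (A⁻ᵀ ξ)| dξ`, where `A⁻ᵀ` is the dilation `(4 ^ (-j), 2 ^ (-j))` after a
rotation which sends the direction `θ₀` almost to the first axis. The integral is cut into the parts
inside and outside the cone.

* Inside the cone, the Cauchy–Schwarz inequality with a Gaussian weight bounds the squared
  coefficient by the integral of `|u|²` against a profile in `|ξ| / 4 ^ j` which vanishes to order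
  `2 σ` at `0` and decays at infinity. Weighted by `4 ^ (2 j s)` and summed over `j`, these profiles
  are at most a multiple of `|ξ| ^ (2 s)`, because `s < σ` (`exists_tsum_sq_lintegral_le`).
* Outside the cone, at scales at which the angle of the grid is accurate enough, the first
  coordinate of `A⁻ᵀ ξ` is smaller than the second by a factor `2 ^ j`. The vanishing of `φ̂` on the
  second axis gains `2 ^ (-j σ)`, and the polynomial growth of `u` in the mean costs `2 ^ (j M)`, so
  that the squared coefficient is of the order of `2 ^ (j (2 M - 2 σ - 1))`
  (`exists_sq_lintegral_le_of_gridRotation`). The assumption on `σ` makes this summable against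
  `4 ^ (2 j s)`.
-/

noncomputable section

namespace Wavepacket

/-! ### The anisotropic matrices -/

theorem toEuclideanCLM_apply_apply (A : Matrix (Fin 2) (Fin 2) ℝ) (x : Plane) (i : Fin 2) :
    Matrix.toEuclideanCLM (n := Fin 2) (𝕜 := ℝ) A x i = A i 0 * x 0 + A i 1 * x 1 := by
  rw [Matrix.ofLp_toEuclideanCLM, Matrix.mulVec, dotProduct, Fin.sum_univ_two]

theorem rotation_apply_zero (θ : ℝ) (x : Plane) :
    Matrix.toEuclideanCLM (n := Fin 2) (𝕜 := ℝ) (rotationMatrix θ) x 0 =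
      Real.cos θ * x 0 - Real.sin θ * x 1 := by
  simp [toEuclideanCLM_apply_apply, rotationMatrix, sub_eq_add_neg]

theorem rotation_apply_one (θ : ℝ) (x : Plane) :
    Matrix.toEuclideanCLM (n := Fin 2) (𝕜 := ℝ) (rotationMatrix θ) x 1 =
      Real.sin θ * x 0 + Real.cos θ * x 1 := by
  simp [toEuclideanCLM_apply_apply, rotationMatrix]

theorem norm_sq_eq (x : Plane) : ‖x‖ ^ 2 = x 0 ^ 2 + x 1 ^ 2 := by
  rw [EuclideanSpace.norm_sq_eq, Fin.sum_univ_two, Real.norm_eq_abs, Real.norm_eq_abs, sq_abs,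
    sq_abs]

theorem norm_sq_rotation (θ : ℝ) (x : Plane) :
    ‖Matrix.toEuclideanCLM (n := Fin 2) (𝕜 := ℝ) (rotationMatrix θ) x‖ ^ 2 = ‖x‖ ^ 2 := by
  rw [norm_sq_eq, norm_sq_eq, rotation_apply_zero, rotation_apply_one]
  linear_combination (x 0 ^ 2 + x 1 ^ 2) * Real.sin_sq_add_cos_sq θ

theorem abs_apply_le_norm (x : Plane) (i : Fin 2) : |x i| ≤ ‖x‖ :=
  PiLp.norm_apply_le x i

theorem dilation_apply_zero (j : ℕ) (x : Plane) :
    Matrix.toEuclideanCLM (n := Fin 2) (𝕜 := ℝ) (dilationMatrix j) x 0 = 4 ^ j * x 0 := by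
  simp [toEuclideanCLM_apply_apply, dilationMatrix]

theorem dilation_apply_one (j : ℕ) (x : Plane) :
    Matrix.toEuclideanCLM (n := Fin 2) (𝕜 := ℝ) (dilationMatrix j) x 1 = 2 ^ j * x 1 := by
  simp [toEuclideanCLM_apply_apply, dilationMatrix]

/-- The rotation by the angle `2 k π / 2 ^ j`. -/
def gridRotation (j k : ℕ) : Plane →L[ℝ] Plane :=
  Matrix.toEuclideanCLM (n := Fin 2) (𝕜 := ℝ) (rotationMatrix (2 * k * Real.pi / 2 ^ j))

theorem norm_gridRotation (j k : ℕ) (x : Plane) : ‖gridRotation j k x‖ = ‖x‖ :=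
  (sq_eq_sq₀ (norm_nonneg _) (norm_nonneg _)).1 (norm_sq_rotation _ x)

theorem parabolicEquiv_eq_dilation (j k : ℕ) (x : Plane) :
    parabolicEquiv j k x =
      Matrix.toEuclideanCLM (n := Fin 2) (𝕜 := ℝ) (dilationMatrix j) (gridRotation j k x) := by
  rw [parabolicEquiv_apply, parabolicMatrix, map_mul]
  rfl

theorem parabolicEquiv_apply_zero (j k : ℕ) (x : Plane) :
    parabolicEquiv j k x 0 = 4 ^ j * gridRotation j k x 0 := by
  rw [parabolicEquiv_eq_dilation, dilation_apply_zero]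

theorem parabolicEquiv_apply_one (j k : ℕ) (x : Plane) :
    parabolicEquiv j k x 1 = 2 ^ j * gridRotation j k x 1 := by
  rw [parabolicEquiv_eq_dilation, dilation_apply_one]

theorem two_pow_mul_norm_le_norm_parabolicEquiv (j k : ℕ) (x : Plane) :
    2 ^ j * ‖x‖ ≤ ‖parabolicEquiv j k x‖ := by
  rw [← norm_gridRotation j k x]
  refine (sq_le_sq₀ (by positivity) (norm_nonneg _)).1 ?_
  rw [mul_pow, norm_sq_eq, norm_sq_eq, parabolicEquiv_apply_zero, parabolicEquiv_apply_one,
    mul_add, mul_pow, mul_pow]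
  gcongr
  norm_num

theorem norm_parabolicEquiv_le (j k : ℕ) :
    ‖(parabolicEquiv j k : Plane →L[ℝ] Plane)‖ ≤ 4 ^ j := by
  refine ContinuousLinearMap.opNorm_le_bound _ (by positivity) fun x => ?_
  rw [← norm_gridRotation j k x]
  refine (sq_le_sq₀ (norm_nonneg _) (by positivity)).1 ?_
  rw [mul_pow, norm_sq_eq, norm_sq_eq, ContinuousLinearEquiv.coe_coe, parabolicEquiv_apply_zero,
    parabolicEquiv_apply_one, mul_add, mul_pow, mul_pow]
  gcongr
  norm_num

/-- The map `A_{j,k}⁻ᵀ = D_j⁻¹ R_{2 k π / 2^j}`, by which the parabolic matrix acts on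
frequencies. -/
def frequencyMap (j k : ℕ) : Plane →L[ℝ] Plane :=
  Matrix.toEuclideanCLM (n := Fin 2) (𝕜 := ℝ)
    (!![(4 ^ j)⁻¹, 0; 0, (2 ^ j)⁻¹] * rotationMatrix (2 * k * Real.pi / 2 ^ j))

theorem frequencyMap_apply_zero (j k : ℕ) (ξ : Plane) :
    frequencyMap j k ξ 0 = gridRotation j k ξ 0 / 4 ^ j := by
  rw [frequencyMap, map_mul]
  change Matrix.toEuclideanCLM (n := Fin 2) (𝕜 := ℝ) !![((4 : ℝ) ^ j)⁻¹, 0; 0, (2 ^ j)⁻¹]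
    (gridRotation j k ξ) 0 = _
  simp [toEuclideanCLM_apply_apply, div_eq_inv_mul]

theorem frequencyMap_apply_one (j k : ℕ) (ξ : Plane) :
    frequencyMap j k ξ 1 = gridRotation j k ξ 1 / 2 ^ j := by
  rw [frequencyMap, map_mul]
  change Matrix.toEuclideanCLM (n := Fin 2) (𝕜 := ℝ) !![((4 : ℝ) ^ j)⁻¹, 0; 0, (2 ^ j)⁻¹]
    (gridRotation j k ξ) 1 = _
  simp [toEuclideanCLM_apply_apply, div_eq_inv_mul]

theorem inner_gridRotation (j k : ℕ) (x ξ : Plane) :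
    inner ℝ (gridRotation j k x) (gridRotation j k ξ) = inner ℝ x ξ := by
  simp only [PiLp.inner_apply, Fin.sum_univ_two, RCLike.inner_apply, conj_trivial, gridRotation,
    rotation_apply_zero, rotation_apply_one]
  linear_combination (x 0 * ξ 0 + x 1 * ξ 1) * Real.sin_sq_add_cos_sq (2 * k * Real.pi / 2 ^ j)

theorem inner_parabolicEquiv_frequencyMap (j k : ℕ) (x ξ : Plane) :
    inner ℝ (parabolicEquiv j k x) (frequencyMap j k ξ) = inner ℝ x ξ := by
  rw [← inner_gridRotation j k x ξ]
  simp only [PiLp.inner_apply, Fin.sum_univ_two, RCLike.inner_apply, conj_trivial,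
    parabolicEquiv_apply_zero, parabolicEquiv_apply_one, frequencyMap_apply_zero,
    frequencyMap_apply_one]
  field_simp

theorem norm_div_le_norm_frequencyMap (j k : ℕ) (ξ : Plane) :
    ‖ξ‖ / 4 ^ j ≤ ‖frequencyMap j k ξ‖ := by
  rw [← norm_gridRotation j k ξ]
  refine (sq_le_sq₀ (by positivity) (norm_nonneg _)).1 ?_
  rw [div_pow, norm_sq_eq, norm_sq_eq, frequencyMap_apply_zero, frequencyMap_apply_one,
    add_div, div_pow, div_pow]
  gcongr
  norm_num

theorem abs_frequencyMap_apply_zero_le (j k : ℕ) (ξ : Plane) :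
    |frequencyMap j k ξ 0| ≤ ‖ξ‖ / 4 ^ j := by
  rw [← norm_gridRotation j k ξ, frequencyMap_apply_zero, abs_div,
    abs_of_pos (by positivity : (0 : ℝ) < 4 ^ j)]
  gcongr
  exact abs_apply_le_norm _ 0

theorem det_rotationMatrix (θ : ℝ) : (rotationMatrix θ).det = 1 := by
  rw [rotationMatrix, Matrix.det_fin_two_of]
  linear_combination Real.sin_sq_add_cos_sq θ

theorem det_toEuclideanCLM (A : Matrix (Fin 2) (Fin 2) ℝ) :
    LinearMap.det (Matrix.toEuclideanCLM (n := Fin 2) (𝕜 := ℝ) A : Plane →ₗ[ℝ] Plane) = A.det := by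
  rw [← LinearMap.det_toLin (EuclideanSpace.basisFun (Fin 2) ℝ).toBasis]
  rfl

theorem eight_pow (j : ℕ) : (8 : ℝ) ^ j = 4 ^ j * 2 ^ j := by
  rw [← mul_pow]
  norm_num

theorem map_parabolicEquiv_volume (j k : ℕ) :
    Measure.map (parabolicEquiv j k) (volume : Measure Plane) =
      ENNReal.ofReal ((8 ^ j)⁻¹) • volume := by
  have hdet : LinearMap.det (Matrix.toEuclideanCLM (n := Fin 2) (𝕜 := ℝ)
      (parabolicMatrix j k) : Plane →ₗ[ℝ] Plane) = 8 ^ j := by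
    rw [det_toEuclideanCLM, parabolicMatrix, Matrix.det_mul, det_rotationMatrix, dilationMatrix,
      Matrix.det_fin_two_of, eight_pow]
    ring
  have h := Measure.map_linearMap_addHaar_eq_smul_addHaar (volume : Measure Plane)
    (f := (Matrix.toEuclideanCLM (n := Fin 2) (𝕜 := ℝ)
      (parabolicMatrix j k) : Plane →ₗ[ℝ] Plane)) (by rw [hdet]; positivity)
  rw [hdet, abs_of_pos (by positivity)] at h
  exact h

theorem map_frequencyMap_volume (j k : ℕ) :
    Measure.map (frequencyMap j k) (volume : Measure Plane) = ENNReal.ofReal (8 ^ j) • volume := by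
  have hdet : LinearMap.det (frequencyMap j k : Plane →ₗ[ℝ] Plane) = (8 ^ j)⁻¹ := by
    rw [frequencyMap, det_toEuclideanCLM, Matrix.det_mul, det_rotationMatrix,
      Matrix.det_fin_two_of, eight_pow, mul_inv]
    ring
  have h := Measure.map_linearMap_addHaar_eq_smul_addHaar (volume : Measure Plane)
    (f := (frequencyMap j k : Plane →ₗ[ℝ] Plane)) (by rw [hdet]; positivity)
  rw [hdet, inv_inv, abs_of_pos (by positivity)] at h
  exact h

/-! ### Fourier transforms of wavepackets -/

theorem integral_comp_parabolicEquiv (j k : ℕ) (F : Plane → ℂ) :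
    ∫ x, F (parabolicEquiv j k x) = ((8 : ℝ) ^ j)⁻¹ • ∫ y, F y := by
  have h := (parabolicEquiv j k).toHomeomorph.measurableEmbedding.integral_map
    (μ := (volume : Measure Plane)) F
  rw [ContinuousLinearEquiv.coe_toHomeomorph, map_parabolicEquiv_volume,
    integral_smul_measure, ENNReal.toReal_ofReal (by positivity)] at h
  exact h.symm

theorem norm_fourier_comp_sub (φ : 𝓢(Plane, ℂ)) (a w : Plane) :
    ‖∫ y, 𝐞 (-inner ℝ y w) • φ (y - a)‖ = ‖(𝓕 φ : 𝓢(Plane, ℂ)) w‖ := by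
  have h : ∀ y : Plane, 𝐞 (-inner ℝ y w) • φ (y - a) =
      𝐞 (-inner ℝ a w) • (𝐞 (-inner ℝ (y - a) w) • φ (y - a)) := by
    intro y
    rw [smul_smul, ← AddChar.map_add_eq_mul, inner_sub_left]
    congr 3
    ring
  simp_rw [h]
  rw [integral_sub_right_eq_self (fun y => 𝐞 (-inner ℝ a w) • (𝐞 (-inner ℝ y w) • φ y)) a]
  simp_rw [Circle.smul_def]
  rw [integral_smul, norm_smul, Circle.norm_coe, one_mul, fourier_coe, Real.fourier_eq]
  simp_rw [Circle.smul_def]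

/-- The normalizing factor of the Fourier transform of a wavepacket: the `L²`
normalization `8 ^ (j/2)` divided by the determinant `8 ^ j` of the parabolic matrix. -/
def wavepacketFactor (j : ℕ) : ℝ := (8 : ℝ) ^ ((j : ℝ) / 2) * (8 ^ j)⁻¹

theorem wavepacketFactor_nonneg (j : ℕ) : 0 ≤ wavepacketFactor j := by
  unfold wavepacketFactor
  positivity

theorem wavepacketFactor_sq_mul (j : ℕ) : wavepacketFactor j ^ 2 * 8 ^ j = 1 := by
  have h : ((8 : ℝ) ^ ((j : ℝ) / 2)) ^ 2 = 8 ^ j := by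
    rw [← Real.rpow_natCast, ← Real.rpow_mul (by norm_num), ← Real.rpow_natCast]
    congr 1
    push_cast
    ring
  rw [wavepacketFactor, mul_pow, h]
  field_simp

/-- The translation by `a` contributes only a phase to the Fourier transform of a wavepacket, and
the parabolic matrix acts on frequencies by its inverse transpose. -/
theorem norm_fourier_wavepacket (φ : 𝓢(Plane, ℂ)) (j k : ℕ) (a ξ : Plane) :
    ‖(𝓕 (wavepacket φ j k a) : 𝓢(Plane, ℂ)) ξ‖ =
      wavepacketFactor j * ‖(𝓕 φ : 𝓢(Plane, ℂ)) (frequencyMap j k ξ)‖ := by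
  let F : Plane → ℂ := fun y =>
    ((8 : ℝ) ^ ((j : ℝ) / 2)) • (𝐞 (-inner ℝ y (frequencyMap j k ξ)) • φ (y - a))
  have h : ∀ x : Plane, 𝐞 (-inner ℝ x ξ) • wavepacket φ j k a x = F (parabolicEquiv j k x) := by
    intro x
    simp only [F, inner_parabolicEquiv_frequencyMap]
    rw [wavepacket_apply, ← parabolicEquiv_apply, smul_comm, Complex.real_smul]
  rw [fourier_coe, Real.fourier_eq, integral_congr_ae (.of_forall h),
    integral_comp_parabolicEquiv j k F, integral_smul, norm_smul, norm_smul,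
    norm_fourier_comp_sub, Real.norm_of_nonneg (by positivity),
    Real.norm_of_nonneg (by positivity), wavepacketFactor]
  ring

theorem norm_fourierInv_conjSchwartz (ψ : 𝓢(Plane, ℂ)) (ξ : Plane) :
    ‖(𝓕⁻ (conjSchwartz ψ) : 𝓢(Plane, ℂ)) ξ‖ = ‖(𝓕 ψ : 𝓢(Plane, ℂ)) ξ‖ := by
  have h : ∀ y : Plane, 𝐞 (inner ℝ y ξ) • conjSchwartz ψ y =
      starRingEnd ℂ (𝐞 (-inner ℝ y ξ) • ψ y) := by
    intro y
    rw [conjSchwartz_apply, Circle.smul_def, Circle.smul_def, smul_eq_mul, smul_eq_mul, map_mul,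
      ← Circle.coe_inv_eq_conj, AddChar.map_neg_eq_inv, inv_inv]
  rw [fourierInv_coe, Real.fourierInv_eq, fourier_coe, Real.fourier_eq]
  simp_rw [h]
  rw [integral_conj, RCLike.norm_conj]

/-! ### Elementary inequalities -/

/-- Along a geometric sequence of scales, a function of the ratio `x / 4 ^ j` that decays
polynomially at `0` and at `∞` has a sum bounded independently of `x`. -/
theorem exists_tsum_min_rpow_le {a : ℝ} (ha : 0 < a) :
    ∃ K : ℝ, 0 ≤ K ∧ ∀ x : ℝ, 0 < x →
      ∑' j : ℕ, ENNReal.ofReal (min ((x / 4 ^ j) ^ a) ((x / 4 ^ j) ^ (-a))) ≤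
        ENNReal.ofReal K := by
  set q : ℝ := 4 ^ (-a) with hq
  have hq0 : 0 < q := by positivity
  have hq1 : q < 1 := Real.rpow_lt_one_of_one_lt_of_neg (by norm_num) (by linarith)
  have hpow : ∀ n : ℕ, ((4 : ℝ) ^ n) ^ (-a) = q ^ n := fun n => by
    rw [← Real.rpow_natCast 4 n, ← Real.rpow_mul (by norm_num), mul_comm,
      Real.rpow_mul (by norm_num), Real.rpow_natCast]
  have hsum : Summable fun i : ℤ => q⁻¹ * q ^ i.natAbs := by
    refine Summable.mul_left _ (Summable.of_nat_of_neg ?_ ?_) <;>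
      simpa using summable_geometric_of_lt_one hq0.le hq1
  refine ⟨∑' i : ℤ, q⁻¹ * q ^ i.natAbs, tsum_nonneg fun i => by positivity, fun x hx => ?_⟩
  rw [ENNReal.ofReal_tsum_of_nonneg (fun i => by positivity) hsum]
  -- With `4 ^ m ≤ x < 4 ^ (m + 1)`, the term of index `j` is at most `q ^ (|j - m| - 1)`.
  obtain ⟨m, hm1, hm2⟩ := exists_mem_Ico_zpow hx (by norm_num : (1 : ℝ) < 4)
  have hinj : Function.Injective fun j : ℕ => (j : ℤ) - m := fun i j h => by
    simpa using h
  refine le_trans (ENNReal.tsum_le_tsum fun j => ENNReal.ofReal_le_ofReal ?_)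
    (ENNReal.tsum_comp_le_tsum_of_injective hinj fun i : ℤ => ENNReal.ofReal (q⁻¹ * q ^ i.natAbs))
  have hqinv : 1 ≤ q⁻¹ := (one_le_inv₀ hq0).2 hq1.le
  have h4 : (0 : ℝ) < 4 ^ j := by positivity
  rcases le_or_gt (j : ℤ) m with hj | hj
  · obtain ⟨n, rfl⟩ := Int.le.dest hj
    have h1 : (4 : ℝ) ^ n ≤ x / 4 ^ j := by
      rw [le_div_iff₀ h4, ← pow_add, ← zpow_natCast]
      convert! hm1 using 2
      push_cast
      ring
    have h2 : ((j : ℤ) - (j + n)).natAbs = n := by omega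
    rw [h2]
    calc min ((x / 4 ^ j) ^ a) ((x / 4 ^ j) ^ (-a)) ≤ (x / 4 ^ j) ^ (-a) := min_le_right _ _
      _ ≤ (4 ^ n) ^ (-a) :=
        Real.rpow_le_rpow_of_nonpos (by positivity) h1 (by linarith)
      _ = 1 * q ^ n := by rw [hpow, one_mul]
      _ ≤ q⁻¹ * q ^ n := by gcongr
  · obtain ⟨n, hn⟩ := Int.le.dest (Int.add_one_le_of_lt hj)
    have h1 : x / 4 ^ j ≤ ((4 : ℝ) ^ n)⁻¹ := by
      rw [div_le_iff₀ h4, inv_mul_eq_div, le_div_iff₀ (by positivity), ← zpow_natCast 4 j, ← hn,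
        zpow_add₀ (by norm_num), zpow_natCast]
      gcongr
    have h2 : ((j : ℤ) - m).natAbs = n + 1 := by omega
    rw [h2]
    calc min ((x / 4 ^ j) ^ a) ((x / 4 ^ j) ^ (-a)) ≤ (x / 4 ^ j) ^ a := min_le_left _ _
      _ ≤ ((4 ^ n)⁻¹) ^ a := by gcongr
      _ = q ^ n := by rw [Real.inv_rpow (by positivity), ← Real.rpow_neg (by positivity), hpow]
      _ = q⁻¹ * q ^ (n + 1) := by rw [pow_succ]; field_simp

/-- Decay of the squared window profile, divided by `t ^ (2 s)`, at both ends. At `0` the vanishing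
of order `σ > s` is used, at `∞` the Gaussian, which is needed only if `s = 0`. -/
theorem exists_rpow_mul_exp_le {s σ δ : ℝ} (hs : 0 ≤ s) (hsσ : s < σ) (hδ : 0 < δ) :
    ∃ C a : ℝ, 0 ≤ C ∧ 0 < a ∧ ∀ t : ℝ, 0 < t →
      t ^ (-(2 * s)) * (min 1 (t ^ σ) ^ 2 * Real.exp (-δ * t ^ 2)) ≤
        C * min (t ^ a) (t ^ (-a)) := by
  -- Near `0` the left-hand side is at most `t ^ (2 σ - 2 s)`; near `∞` it is at most
  -- `δ⁻¹ t ^ (-2)`, and any exponent up to `2` would do there.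
  refine ⟨max 1 δ⁻¹, min 1 (2 * σ - 2 * s), by positivity, lt_min one_pos (by linarith),
    fun t ht => ?_⟩
  set a : ℝ := min 1 (2 * σ - 2 * s)
  have ha : 0 < a := lt_min one_pos (by linarith)
  have hexp : Real.exp (-δ * t ^ 2) ≤ 1 := Real.exp_le_one_iff.2 (by nlinarith [sq_nonneg t])
  rcases le_total t 1 with h | h
  · have hmin : min (t ^ a) (t ^ (-a)) = t ^ a :=
      min_eq_left (Real.rpow_le_rpow_of_exponent_ge ht h (by linarith))
    rw [hmin]
    calc t ^ (-(2 * s)) * (min 1 (t ^ σ) ^ 2 * Real.exp (-δ * t ^ 2))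
        ≤ t ^ (-(2 * s)) * ((t ^ σ) ^ 2 * 1) := by
          gcongr
          exact min_le_right _ _
      _ = t ^ (2 * σ - 2 * s) := by
          rw [mul_one, ← Real.rpow_natCast, ← Real.rpow_mul ht.le, ← Real.rpow_add ht]
          congr 1
          push_cast
          ring
      _ ≤ 1 * t ^ a := by
          rw [one_mul]
          exact Real.rpow_le_rpow_of_exponent_ge ht h (min_le_right _ _)
      _ ≤ max 1 δ⁻¹ * t ^ a := by
          gcongr
          exact le_max_left _ _
  · have hmin : min (t ^ a) (t ^ (-a)) = t ^ (-a) :=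
      min_eq_right (Real.rpow_le_rpow_of_exponent_le h (by linarith))
    rw [hmin]
    have h1 : Real.exp (-δ * t ^ 2) ≤ δ⁻¹ * t ^ (-a) := by
      have h2 : t ^ a ≤ t ^ 2 := by
        rw [← Real.rpow_natCast]
        refine Real.rpow_le_rpow_of_exponent_le h ((min_le_left _ _).trans ?_)
        norm_num
      rw [neg_mul, Real.exp_neg, Real.rpow_neg ht.le, ← mul_inv]
      gcongr
      calc δ * t ^ a ≤ δ * t ^ 2 := by gcongr
        _ ≤ Real.exp (δ * t ^ 2) := by linarith [Real.add_one_le_exp (δ * t ^ 2)]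
    calc t ^ (-(2 * s)) * (min 1 (t ^ σ) ^ 2 * Real.exp (-δ * t ^ 2))
        ≤ 1 * (1 ^ 2 * (δ⁻¹ * t ^ (-a))) := by
          gcongr
          · exact Real.rpow_le_one_of_one_le_of_nonpos h (by linarith)
          · exact min_le_left _ _
      _ = δ⁻¹ * t ^ (-a) := by ring
      _ ≤ max 1 δ⁻¹ * t ^ (-a) := by
          gcongr
          exact le_max_right _ _

/-- The multiplier estimate behind the bound in the cone: the squared window profiles, weighted
by `4 ^ (2 j s)`, add up to at most a multiple of `r ^ (2 s)`. Only `s < σ` is needed. -/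
theorem exists_tsum_profile_le {s σ δ : ℝ} (hs : 0 ≤ s) (hsσ : s < σ) (hδ : 0 < δ) :
    ∃ K : ℝ, 0 ≤ K ∧ ∀ r : ℝ, 0 ≤ r →
      ∑' j : ℕ, ENNReal.ofReal ((4 : ℝ) ^ (2 * (j : ℝ) * s) *
        (min 1 ((r / 4 ^ j) ^ σ) ^ 2 * Real.exp (-δ * (r / 4 ^ j) ^ 2))) ≤
        ENNReal.ofReal (K * r ^ (2 * s)) := by
  obtain ⟨C, a, hC, ha, hCa⟩ := exists_rpow_mul_exp_le hs hsσ hδ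
  obtain ⟨K, hK, hKa⟩ := exists_tsum_min_rpow_le ha
  refine ⟨C * K, by positivity, fun r hr => ?_⟩
  rcases hr.eq_or_lt with rfl | hr
  · have hσ : σ ≠ 0 := by linarith
    simp [Real.zero_rpow hσ]
  have hterm : ∀ j : ℕ, (4 : ℝ) ^ (2 * (j : ℝ) * s) *
      (min 1 ((r / 4 ^ j) ^ σ) ^ 2 * Real.exp (-δ * (r / 4 ^ j) ^ 2)) ≤
      (r ^ (2 * s) * C) * min ((r / 4 ^ j) ^ a) ((r / 4 ^ j) ^ (-a)) := by
    intro j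
    have ht : 0 < r / 4 ^ j := by positivity
    have h4 : (4 : ℝ) ^ (2 * (j : ℝ) * s) = r ^ (2 * s) * (r / 4 ^ j) ^ (-(2 * s)) := by
      rw [Real.rpow_neg ht.le, Real.div_rpow hr.le (by positivity), inv_div,
        mul_div_cancel₀ _ (Real.rpow_pos_of_pos hr _).ne', ← Real.rpow_natCast,
        ← Real.rpow_mul (by norm_num)]
      congr 1
      ring
    rw [h4, mul_assoc, mul_assoc]
    exact mul_le_mul_of_nonneg_left (hCa _ ht) (by positivity)
  calc _ ≤ ∑' j : ℕ, ENNReal.ofReal (r ^ (2 * s) * C) *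
        ENNReal.ofReal (min ((r / 4 ^ j) ^ a) ((r / 4 ^ j) ^ (-a))) := by
        refine ENNReal.tsum_le_tsum fun j => ?_
        rw [← ENNReal.ofReal_mul (by positivity)]
        exact ENNReal.ofReal_le_ofReal (hterm j)
    _ = ENNReal.ofReal (r ^ (2 * s) * C) *
        ∑' j : ℕ, ENNReal.ofReal (min ((r / 4 ^ j) ^ a) ((r / 4 ^ j) ^ (-a))) :=
        ENNReal.tsum_mul_left
    _ ≤ ENNReal.ofReal (r ^ (2 * s) * C) * ENNReal.ofReal K := by
        gcongr
        exact hKa r hr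
    _ = ENNReal.ofReal (C * K * r ^ (2 * s)) := by
        rw [← ENNReal.ofReal_mul (by positivity)]
        congr 1
        ring

theorem exists_one_add_rpow_le_exp {p c : ℝ} (hp : 0 < p) (hc : 0 < c) :
    ∃ A : ℝ, 0 ≤ A ∧ ∀ t : ℝ, 0 ≤ t → (1 + t) ^ p ≤ A * Real.exp (c * t ^ 2) := by
  -- It suffices to bound `1 + t` by a multiple of `exp (b t ^ 2)` and to take the power `p`.
  set b : ℝ := c / p with hb
  have hb0 : 0 < b := by positivity
  refine ⟨(2 + b⁻¹) ^ p, by positivity, fun t ht => ?_⟩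
  have h1 : 1 + t ≤ (2 + b⁻¹) * Real.exp (b * t ^ 2) := by
    calc 1 + t ≤ (2 + b⁻¹) * (1 + b * t ^ 2) := by
          have : (2 + b⁻¹) * (1 + b * t ^ 2) = 2 + b⁻¹ + 2 * b * t ^ 2 + t ^ 2 := by
            field_simp
            ring
          rw [this]
          have : 0 < b⁻¹ := by positivity
          nlinarith [sq_nonneg (t - 1), mul_nonneg hb0.le (sq_nonneg t)]
      _ ≤ _ := by
          gcongr
          linarith [Real.add_one_le_exp (b * t ^ 2)]
  calc (1 + t) ^ p ≤ ((2 + b⁻¹) * Real.exp (b * t ^ 2)) ^ p := by gcongr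
    _ = (2 + b⁻¹) ^ p * Real.exp (c * t ^ 2) := by
        rw [Real.mul_rpow (by positivity) (by positivity), ← Real.exp_mul, hb]
        congr 2
        field_simp

/-! ### Geometry of the cone -/

theorem isClosed_cone (ε : ℝ) : IsClosed (cone ε) :=
  isClosed_le (by fun_prop) (by fun_prop)

theorem mem_rotatedCone_iff (θ ε : ℝ) (ξ : Plane) :
    ξ ∈ rotatedCone θ ε ↔
      Matrix.toEuclideanCLM (n := Fin 2) (𝕜 := ℝ) (rotationMatrix (-θ)) ξ ∈ cone ε := by
  have h : ∀ (α : ℝ) (x : Plane), Matrix.toEuclideanCLM (n := Fin 2) (𝕜 := ℝ) (rotationMatrix (-α))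
      (Matrix.toEuclideanCLM (n := Fin 2) (𝕜 := ℝ) (rotationMatrix α) x) = x := by
    intro α x
    ext i
    fin_cases i
    · change Matrix.toEuclideanCLM (n := Fin 2) (𝕜 := ℝ) (rotationMatrix (-α)) _ 0 = x 0
      simp only [rotation_apply_zero, rotation_apply_one, Real.cos_neg, Real.sin_neg]
      linear_combination x 0 * Real.sin_sq_add_cos_sq α
    · change Matrix.toEuclideanCLM (n := Fin 2) (𝕜 := ℝ) (rotationMatrix (-α)) _ 1 = x 1
      simp only [rotation_apply_zero, rotation_apply_one, Real.cos_neg, Real.sin_neg]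
      linear_combination x 1 * Real.sin_sq_add_cos_sq α
  constructor
  · rintro ⟨x, hx, rfl⟩
    rwa [h]
  · intro hξ
    refine ⟨_, hξ, ?_⟩
    simpa using h (-θ) ξ

theorem measurableSet_rotatedCone (θ ε : ℝ) : MeasurableSet (rotatedCone θ ε) := by
  have h : rotatedCone θ ε =
      Matrix.toEuclideanCLM (n := Fin 2) (𝕜 := ℝ) (rotationMatrix (-θ)) ⁻¹' cone ε := by
    ext ξ
    exact mem_rotatedCone_iff θ ε ξ
  rw [h]
  exact ((isClosed_cone ε).preimage (ContinuousLinearMap.continuous _)).measurableSet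

/-- Outside the cone around the direction `θ₀`, the rotations of the grid at small scales bring
frequencies into a fixed cone around the second axis: the grid angle misses `2 π - θ₀` by at most
`2 π / 2 ^ j`, which is eventually small compared with the opening `ε`. -/
theorem exists_gridRotation_bound {θ₀ ε : ℝ} (hε : 0 < ε) :
    ∃ (K : ℝ) (J : ℕ), 0 ≤ K ∧ ∀ j k : ℕ, J ≤ j →
      2 * Real.pi * k / 2 ^ j ≤ 2 * Real.pi - θ₀ →
      2 * Real.pi - θ₀ ≤ 2 * Real.pi * (k + 1) / 2 ^ j →
      ∀ ξ ∉ rotatedCone θ₀ ε, |gridRotation j k ξ 0| ≤ K * |gridRotation j k ξ 1| := by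
  have hlim : Filter.Tendsto (fun j : ℕ => 2 * Real.pi * (1 / 2 : ℝ) ^ j) Filter.atTop (𝓝 0) := by
    simpa using (tendsto_pow_atTop_nhds_zero_of_lt_one (by norm_num : (0 : ℝ) ≤ 1 / 2)
      (by norm_num)).const_mul (2 * Real.pi)
  obtain ⟨J, hJ⟩ := Filter.eventually_atTop.1
    (hlim.eventually_lt_const (lt_min (by positivity : 0 < ε / 4) (by norm_num : (0 : ℝ) < 1 / 2)))
  refine ⟨2 * (1 / ε + 1), J, by positivity, fun j k hj h1 h2 ξ hξ => ?_⟩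
  -- The grid angle is `2 π - (θ₀ + α)`, so that the grid rotation is the rotation by `-θ₀`, which
  -- sends `ξ` to `(z₀, z₁)` below, followed by the rotation by `-α`.
  obtain ⟨α, hα⟩ : ∃ α, α = 2 * Real.pi - θ₀ - 2 * Real.pi * k / 2 ^ j := ⟨_, rfl⟩
  have hα0 : 0 ≤ α := by linarith
  have hα1 : α < min (ε / 4) (1 / 2) := by
    refine lt_of_le_of_lt ?_ (hJ j hj)
    rw [one_div, inv_pow, ← div_eq_mul_inv]
    rw [mul_add, add_div, mul_one] at h2
    linarith
  have hαε : α < ε / 4 := hα1.trans_le (min_le_left _ _)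
  have hαh : α < 1 / 2 := hα1.trans_le (min_le_right _ _)
  have hangle : 2 * k * Real.pi / 2 ^ j = 2 * Real.pi - (θ₀ + α) := by
    rw [hα]
    ring
  rw [mem_rotatedCone_iff, cone, Set.mem_ofPred_eq, not_le, rotation_apply_zero, rotation_apply_one,
    Real.cos_neg, Real.sin_neg] at hξ
  obtain ⟨z₀, hz₀⟩ : ∃ z, z = Real.cos θ₀ * ξ 0 - -Real.sin θ₀ * ξ 1 := ⟨_, rfl⟩
  obtain ⟨z₁, hz₁⟩ : ∃ z, z = -Real.sin θ₀ * ξ 0 + Real.cos θ₀ * ξ 1 := ⟨_, rfl⟩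
  rw [← hz₀, ← hz₁] at hξ
  have e0 : gridRotation j k ξ 0 = Real.cos α * z₀ + Real.sin α * z₁ := by
    rw [gridRotation, rotation_apply_zero, hangle, Real.cos_two_pi_sub, Real.sin_two_pi_sub,
      Real.cos_add, Real.sin_add, hz₀, hz₁]
    ring
  have e1 : gridRotation j k ξ 1 = -Real.sin α * z₀ + Real.cos α * z₁ := by
    rw [gridRotation, rotation_apply_one, hangle, Real.cos_two_pi_sub, Real.sin_two_pi_sub,
      Real.cos_add, Real.sin_add, hz₀, hz₁]
    ring
  have hsin : |Real.sin α| ≤ ε / 4 :=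
    (Real.abs_sin_le_abs.trans (abs_of_nonneg hα0).le).trans hαε.le
  have hcos : 3 / 4 ≤ Real.cos α := by nlinarith [Real.one_sub_sq_div_two_le_cos (x := α)]
  have hz : |z₀| ≤ 1 / ε * |z₁| := by
    rw [one_div, inv_mul_eq_div, le_div_iff₀ hε]
    linarith
  have hlow : 1 / 2 * |z₁| ≤ |gridRotation j k ξ 1| := by
    have h3 : |Real.sin α * z₀| ≤ 1 / 4 * |z₁| := by
      rw [abs_mul]
      calc |Real.sin α| * |z₀| ≤ ε / 4 * (1 / ε * |z₁|) := by gcongr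
        _ = 1 / 4 * |z₁| := by field_simp
    have h4 : 3 / 4 * |z₁| ≤ |Real.cos α * z₁| := by
      rw [abs_mul, abs_of_nonneg (by linarith : 0 ≤ Real.cos α)]
      gcongr
    have h5 : |Real.cos α * z₁| - |Real.sin α * z₀| ≤ |gridRotation j k ξ 1| := by
      rw [e1, neg_mul, neg_add_eq_sub]
      exact abs_sub_abs_le_abs_sub _ _
    linarith
  calc |gridRotation j k ξ 0| ≤ |Real.cos α * z₀| + |Real.sin α * z₁| := by
        rw [e0]
        exact abs_add_le _ _
    _ ≤ 1 * |z₀| + 1 * |z₁| := by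
        rw [abs_mul, abs_mul]
        gcongr
        · exact Real.abs_cos_le_one α
        · exact Real.abs_sin_le_one α
    _ ≤ (1 / ε + 1) * |z₁| := by linarith
    _ = 2 * (1 / ε + 1) * (1 / 2 * |z₁|) := by ring
    _ ≤ 2 * (1 / ε + 1) * |gridRotation j k ξ 1| := by gcongr

/-! ### Weighted estimates on the frequency side -/

open scoped ENNReal

theorem sq_lintegral_mul_le {α : Type*} [MeasurableSpace α] (μ : Measure α) {f g : α → ℝ≥0∞}
    (hf : AEMeasurable f μ) (hg : AEMeasurable g μ) :
    (∫⁻ x, f x * g x ∂μ) ^ 2 ≤ (∫⁻ x, f x ^ 2 ∂μ) * ∫⁻ x, g x ^ 2 ∂μ := by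
  have h := ENNReal.lintegral_mul_le_Lp_mul_Lq μ Real.HolderConjugate.two_two hf hg
  simp only [Pi.mul_apply, ENNReal.rpow_two] at h
  calc (∫⁻ x, f x * g x ∂μ) ^ 2
      ≤ ((∫⁻ x, f x ^ 2 ∂μ) ^ (1 / 2 : ℝ) * (∫⁻ x, g x ^ 2 ∂μ) ^ (1 / 2 : ℝ)) ^ 2 := by gcongr
    _ = (∫⁻ x, f x ^ 2 ∂μ) * ∫⁻ x, g x ^ 2 ∂μ := by
        rw [mul_pow, ← ENNReal.rpow_two, ← ENNReal.rpow_two, ← ENNReal.rpow_mul,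
          ← ENNReal.rpow_mul]
        norm_num

theorem lintegral_exp_neg_mul_sq_norm {b : ℝ} (hb : 0 < b) :
    ∫⁻ ξ : Plane, ENNReal.ofReal (Real.exp (-b * ‖ξ‖ ^ 2)) = ENNReal.ofReal (Real.pi / b) := by
  have h := GaussianFourier.integral_rexp_neg_mul_sq_norm (V := Plane) hb
  have h2 : ((Module.finrank ℝ Plane : ℝ) / 2) = 1 := by simp
  rw [h2, Real.rpow_one] at h
  have hint : Integrable fun ξ : Plane => Real.exp (-b * ‖ξ‖ ^ 2) := by
    -- Otherwise the integral would be `0` by convention.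
    by_contra hn
    rw [integral_undef hn] at h
    have : 0 < Real.pi / b := by positivity
    linarith
  rw [← h, ofReal_integral_eq_lintegral_ofReal hint (.of_forall fun ξ => (Real.exp_pos _).le)]

theorem lintegral_exp_neg_mul_sq_norm_frequencyMap {b : ℝ} (hb : 0 < b) (j k : ℕ) :
    ∫⁻ ξ : Plane, ENNReal.ofReal (Real.exp (-b * ‖frequencyMap j k ξ‖ ^ 2)) =
      ENNReal.ofReal (8 ^ j) * ENNReal.ofReal (Real.pi / b) := by
  rw [← lintegral_exp_neg_mul_sq_norm hb, ← smul_eq_mul, ← lintegral_smul_measure,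
    ← map_frequencyMap_volume j k, lintegral_map (by fun_prop) (by fun_prop)]

/-- Contribution of one scale over an arbitrary region, by the Cauchy–Schwarz inequality with the
Gaussian of `A_{j,k}⁻ᵀ ξ` as weight; its integral is of the order of the determinant `8 ^ j`,
which the normalization of the wavepacket cancels. -/
theorem sq_lintegral_mul_frequencyMap_le {C δ σ : ℝ} (hC : 0 ≤ C) (hδ : 0 < δ) (hσ : 0 ≤ σ)
    {Φ : Plane → ℂ}
    (hΦb : ∀ ξ, ‖Φ ξ‖ ≤ C * min 1 (|ξ 0| ^ σ) * Real.exp (-δ * ‖ξ‖ ^ 2))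
    {v : Plane → ℝ≥0∞} (hv : AEMeasurable v) (S : Set Plane) (j k : ℕ) :
    (ENNReal.ofReal (wavepacketFactor j) *
      ∫⁻ ξ in S, v ξ * ENNReal.ofReal ‖Φ (frequencyMap j k ξ)‖) ^ 2 ≤
      ENNReal.ofReal (C ^ 2 * (Real.pi / δ)) * ∫⁻ ξ in S, v ξ ^ 2 * ENNReal.ofReal
        (min 1 ((‖ξ‖ / 4 ^ j) ^ σ) ^ 2 * Real.exp (-δ * (‖ξ‖ / 4 ^ j) ^ 2)) := by
  have hpt : ∀ ξ : Plane, ‖Φ (frequencyMap j k ξ)‖ ≤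
      (C * (min 1 ((‖ξ‖ / 4 ^ j) ^ σ) * Real.exp (-(δ / 2) * (‖ξ‖ / 4 ^ j) ^ 2))) *
        Real.exp (-(δ / 2) * ‖frequencyMap j k ξ‖ ^ 2) := by
    intro ξ
    have hexp : Real.exp (-δ * ‖frequencyMap j k ξ‖ ^ 2) ≤
        Real.exp (-(δ / 2) * (‖ξ‖ / 4 ^ j) ^ 2) *
          Real.exp (-(δ / 2) * ‖frequencyMap j k ξ‖ ^ 2) := by
      rw [← Real.exp_add, Real.exp_le_exp]
      have h1 : (‖ξ‖ / 4 ^ j) ^ 2 ≤ ‖frequencyMap j k ξ‖ ^ 2 := by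
        gcongr
        exact norm_div_le_norm_frequencyMap j k ξ
      nlinarith
    calc ‖Φ (frequencyMap j k ξ)‖
        ≤ C * min 1 (|frequencyMap j k ξ 0| ^ σ) *
          Real.exp (-δ * ‖frequencyMap j k ξ‖ ^ 2) := hΦb _
      _ ≤ C * min 1 ((‖ξ‖ / 4 ^ j) ^ σ) * (Real.exp (-(δ / 2) * (‖ξ‖ / 4 ^ j) ^ 2) *
          Real.exp (-(δ / 2) * ‖frequencyMap j k ξ‖ ^ 2)) := by
          gcongr
          exact abs_frequencyMap_apply_zero_le j k ξ
      _ = _ := by ring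
  set F : Plane → ℝ≥0∞ := fun ξ => v ξ * ENNReal.ofReal
    (C * (min 1 ((‖ξ‖ / 4 ^ j) ^ σ) * Real.exp (-(δ / 2) * (‖ξ‖ / 4 ^ j) ^ 2))) with hF
  set G : Plane → ℝ≥0∞ := fun ξ =>
    ENNReal.ofReal (Real.exp (-(δ / 2) * ‖frequencyMap j k ξ‖ ^ 2)) with hG
  have hle : ∫⁻ ξ in S, v ξ * ENNReal.ofReal ‖Φ (frequencyMap j k ξ)‖ ≤
      ∫⁻ ξ in S, F ξ * G ξ := by
    refine lintegral_mono fun ξ => ?_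
    rw [hF, hG, mul_assoc, ← ENNReal.ofReal_mul (by positivity)]
    gcongr
    exact hpt ξ
  have hF2 : ∫⁻ ξ in S, F ξ ^ 2 = ENNReal.ofReal (C ^ 2) * ∫⁻ ξ in S, v ξ ^ 2 * ENNReal.ofReal
        (min 1 ((‖ξ‖ / 4 ^ j) ^ σ) ^ 2 * Real.exp (-δ * (‖ξ‖ / 4 ^ j) ^ 2)) := by
    rw [← lintegral_const_mul' _ _ ENNReal.ofReal_ne_top]
    congr 1 with ξ
    rw [hF, mul_pow, ← ENNReal.ofReal_pow (by positivity),
      mul_left_comm (ENNReal.ofReal (C ^ 2)),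
      ← ENNReal.ofReal_mul (by positivity)]
    congr 2
    rw [mul_pow, mul_pow, ← Real.exp_nat_mul]
    congr 3
    push_cast
    ring
  have hG2 : ∫⁻ ξ in S, G ξ ^ 2 ≤ ENNReal.ofReal (8 ^ j) * ENNReal.ofReal (Real.pi / δ) := by
    rw [← lintegral_exp_neg_mul_sq_norm_frequencyMap hδ j k]
    refine (setLIntegral_le_lintegral _ _).trans_eq ?_
    congr 1 with ξ
    rw [hG, ← ENNReal.ofReal_pow (by positivity), ← Real.exp_nat_mul]
    congr 2
    push_cast
    ring
  have hFm : AEMeasurable F (volume.restrict S) := by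
    refine hv.restrict.mul (Measurable.aemeasurable ?_)
    fun_prop
  have hGm : AEMeasurable G (volume.restrict S) := by
    refine Measurable.aemeasurable ?_
    fun_prop
  calc _ ≤ (ENNReal.ofReal (wavepacketFactor j) * ∫⁻ ξ in S, F ξ * G ξ) ^ 2 := by gcongr
    _ ≤ ENNReal.ofReal (wavepacketFactor j) ^ 2 *
        ((∫⁻ ξ in S, F ξ ^ 2) * ∫⁻ ξ in S, G ξ ^ 2) := by
        rw [mul_pow]
        gcongr
        exact sq_lintegral_mul_le _ hFm hGm
    _ ≤ ENNReal.ofReal (wavepacketFactor j) ^ 2 *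
        ((∫⁻ ξ in S, F ξ ^ 2) * (ENNReal.ofReal (8 ^ j) * ENNReal.ofReal (Real.pi / δ))) := by
        gcongr
    _ = (ENNReal.ofReal (wavepacketFactor j) ^ 2 * ENNReal.ofReal (8 ^ j)) *
        (ENNReal.ofReal (Real.pi / δ) * ∫⁻ ξ in S, F ξ ^ 2) := by ring
    _ = _ := by
        rw [← ENNReal.ofReal_pow (wavepacketFactor_nonneg j),
          ← ENNReal.ofReal_mul (by positivity), wavepacketFactor_sq_mul, ENNReal.ofReal_one,
          one_mul, hF2, ← mul_assoc, ← ENNReal.ofReal_mul (by positivity), mul_comm (Real.pi / δ)]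

/-- The contribution of a region on which `v` is square integrable with weight `|ξ| ^ (2 s)`:
summing over the scales under the integral leaves the multiplier of `exists_tsum_profile_le`. -/
theorem exists_tsum_sq_lintegral_le {s C δ σ : ℝ} (hs : 0 ≤ s) (hsσ : s < σ) (hC : 0 ≤ C)
    (hδ : 0 < δ) {Φ : Plane → ℂ}
    (hΦb : ∀ ξ, ‖Φ ξ‖ ≤ C * min 1 (|ξ 0| ^ σ) * Real.exp (-δ * ‖ξ‖ ^ 2))
    {v : Plane → ℝ≥0∞} (hv : AEMeasurable v) {S : Set Plane}
    (hvS : ∫⁻ ξ in S, v ξ ^ 2 * ENNReal.ofReal (‖ξ‖ ^ (2 * s)) ≠ ⊤) (k : ℕ → ℕ) :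
    ∑' j : ℕ, ENNReal.ofReal ((4 : ℝ) ^ (2 * (j : ℝ) * s)) *
      (ENNReal.ofReal (wavepacketFactor j) *
        ∫⁻ ξ in S, v ξ * ENNReal.ofReal ‖Φ (frequencyMap j (k j) ξ)‖) ^ 2 ≠ ⊤ := by
  obtain ⟨K, hK, hKr⟩ := exists_tsum_profile_le hs hsσ hδ
  set P : ℕ → Plane → ℝ := fun j ξ =>
    min 1 ((‖ξ‖ / 4 ^ j) ^ σ) ^ 2 * Real.exp (-δ * (‖ξ‖ / 4 ^ j) ^ 2) with hP
  have hPm : ∀ j, Measurable (P j) := fun j => by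
    simp only [hP]
    fun_prop
  refine ne_top_of_le_ne_top (ENNReal.mul_ne_top (ENNReal.ofReal_ne_top
    (r := C ^ 2 * (Real.pi / δ))) (ENNReal.mul_ne_top (ENNReal.ofReal_ne_top (r := K)) hvS)) ?_
  calc _ ≤ ∑' j : ℕ, ENNReal.ofReal (C ^ 2 * (Real.pi / δ)) * ∫⁻ ξ in S, v ξ ^ 2 *
        ENNReal.ofReal ((4 : ℝ) ^ (2 * (j : ℝ) * s) * P j ξ) := by
        refine ENNReal.tsum_le_tsum fun j => ?_
        refine (mul_le_mul_right (sq_lintegral_mul_frequencyMap_le hC hδ (hs.trans hsσ.le)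
          hΦb hv S j (k j)) _).trans_eq ?_
        rw [mul_left_comm, ← lintegral_const_mul' _ _ ENNReal.ofReal_ne_top]
        congr 2 with ξ
        simp only [hP]
        rw [mul_left_comm, ← ENNReal.ofReal_mul (by positivity)]
    _ = ENNReal.ofReal (C ^ 2 * (Real.pi / δ)) * ∫⁻ ξ in S, v ξ ^ 2 *
        ∑' j : ℕ, ENNReal.ofReal ((4 : ℝ) ^ (2 * (j : ℝ) * s) * P j ξ) := by
        rw [ENNReal.tsum_mul_left, ← lintegral_tsum]
        · simp_rw [ENNReal.tsum_mul_left]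
        · intro j
          exact (hv.restrict.pow_const 2).mul
            ((hPm j).const_mul _).ennreal_ofReal.aemeasurable
    _ ≤ ENNReal.ofReal (C ^ 2 * (Real.pi / δ)) * ∫⁻ ξ in S, ENNReal.ofReal K *
        (v ξ ^ 2 * ENNReal.ofReal (‖ξ‖ ^ (2 * s))) := by
        refine mul_le_mul_right (lintegral_mono fun ξ => ?_) _
        rw [mul_left_comm, ← ENNReal.ofReal_mul hK]
        gcongr
        exact hKr _ (norm_nonneg ξ)
    _ = _ := by rw [lintegral_const_mul' _ _ ENNReal.ofReal_ne_top]

/-- If the grid rotation maps `ξ` into a cone around the second axis, then the second coordinate of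
`A_{j,k}⁻ᵀ ξ` is of the order of `|ξ| / 2 ^ j`, and the first one is smaller by a factor `2 ^ j`. -/
theorem norm_le_of_frequencyMap_bound {K C δ σ : ℝ} (hK : 0 ≤ K) (hC : 0 ≤ C)
    (hδ : 0 < δ) (hσ : 0 ≤ σ) {Φ : Plane → ℂ}
    (hΦb : ∀ ξ, ‖Φ ξ‖ ≤ C * min 1 (|ξ 0| ^ σ) * Real.exp (-δ * ‖ξ‖ ^ 2)) (j k : ℕ) {ξ : Plane}
    (hξ : |gridRotation j k ξ 0| ≤ K * |gridRotation j k ξ 1|) :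
    ‖Φ (frequencyMap j k ξ)‖ ≤ C * K ^ σ * (((2 : ℝ) ^ j)⁻¹) ^ σ *
      ((‖ξ‖ / 2 ^ j) ^ σ * Real.exp (-(δ / (K ^ 2 + 1)) * (‖ξ‖ / 2 ^ j) ^ 2)) := by
  have h42 : (4 : ℝ) ^ j = 2 ^ j * 2 ^ j := by
    rw [← mul_pow]
    norm_num
  have h0 : |frequencyMap j k ξ 0| ≤ K * (2 ^ j)⁻¹ * (‖ξ‖ / 2 ^ j) := by
    rw [frequencyMap_apply_zero, abs_div, abs_of_pos (by positivity : (0 : ℝ) < 4 ^ j), h42]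
    calc |gridRotation j k ξ 0| / (2 ^ j * 2 ^ j) ≤ K * ‖ξ‖ / (2 ^ j * 2 ^ j) := by
          gcongr
          refine hξ.trans ?_
          rw [← norm_gridRotation j k ξ]
          gcongr
          exact abs_apply_le_norm _ 1
      _ = K * (2 ^ j)⁻¹ * (‖ξ‖ / 2 ^ j) := by
          field_simp
  have h1 : (‖ξ‖ / 2 ^ j) ^ 2 ≤ (K ^ 2 + 1) * ‖frequencyMap j k ξ‖ ^ 2 := by
    have h2 : ‖ξ‖ ^ 2 ≤ (K ^ 2 + 1) * gridRotation j k ξ 1 ^ 2 := by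
      rw [← norm_gridRotation j k ξ, norm_sq_eq, add_mul, one_mul]
      gcongr
      rw [← sq_abs (gridRotation j k ξ 0), ← sq_abs (gridRotation j k ξ 1), ← mul_pow]
      gcongr
    calc (‖ξ‖ / 2 ^ j) ^ 2 = ‖ξ‖ ^ 2 / (2 ^ j) ^ 2 := div_pow _ _ _
      _ ≤ (K ^ 2 + 1) * gridRotation j k ξ 1 ^ 2 / (2 ^ j) ^ 2 := by gcongr
      _ = (K ^ 2 + 1) * frequencyMap j k ξ 1 ^ 2 := by
          rw [frequencyMap_apply_one, div_pow, mul_div_assoc]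
      _ ≤ (K ^ 2 + 1) * ‖frequencyMap j k ξ‖ ^ 2 := by
          rw [norm_sq_eq]
          gcongr
          exact le_add_of_nonneg_left (sq_nonneg _)
  calc ‖Φ (frequencyMap j k ξ)‖
      ≤ C * min 1 (|frequencyMap j k ξ 0| ^ σ) * Real.exp (-δ * ‖frequencyMap j k ξ‖ ^ 2) := hΦb _
    _ ≤ C * (K * (2 ^ j)⁻¹ * (‖ξ‖ / 2 ^ j)) ^ σ *
        Real.exp (-(δ / (K ^ 2 + 1)) * (‖ξ‖ / 2 ^ j) ^ 2) := by
        gcongr ?_ * ?_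
        · gcongr
          exact (min_le_right _ _).trans (by gcongr)
        · rw [Real.exp_le_exp, neg_mul, neg_mul, neg_le_neg_iff, div_mul_eq_mul_div,
            div_le_iff₀ (by positivity)]
          calc δ * (‖ξ‖ / 2 ^ j) ^ 2 ≤ δ * ((K ^ 2 + 1) * ‖frequencyMap j k ξ‖ ^ 2) := by gcongr
            _ = _ := by ring
    _ = _ := by
        rw [Real.mul_rpow (by positivity) (by positivity), Real.mul_rpow hK (by positivity)]
        ring

/-- The contribution of a region which the grid rotation maps into a cone around the second axis.
There the first coordinate of `A_{j,k}⁻ᵀ ξ` is smaller than the second by a factor `2 ^ j`, so that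
the vanishing of order `σ` of the window gains `2 ^ (-j σ)`, against a loss of `2 ^ (j M)` from the
polynomial growth of `v`. -/
theorem exists_sq_lintegral_le_of_gridRotation {M K C δ σ : ℝ} (hM : 0 ≤ M) (hK : 0 ≤ K)
    (hC : 0 ≤ C) (hδ : 0 < δ) (hσ : 0 < σ) {Φ : Plane → ℂ}
    (hΦb : ∀ ξ, ‖Φ ξ‖ ≤ C * min 1 (|ξ 0| ^ σ) * Real.exp (-δ * ‖ξ‖ ^ 2))
    {v : Plane → ℝ≥0∞} (hv : AEMeasurable v)
    (hvM : ∫⁻ ξ, v ξ ^ 2 * ENNReal.ofReal ((1 + ‖ξ‖) ^ (-2 * M)) ≠ ⊤) :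
    ∃ D : ℝ≥0∞, D ≠ ⊤ ∧ ∀ (S : Set Plane) (j k : ℕ), MeasurableSet S →
      (∀ ξ ∈ S, |gridRotation j k ξ 0| ≤ K * |gridRotation j k ξ 1|) →
      (ENNReal.ofReal (wavepacketFactor j) *
        ∫⁻ ξ in S, v ξ * ENNReal.ofReal ‖Φ (frequencyMap j k ξ)‖) ^ 2 ≤
        D * ENNReal.ofReal ((2 : ℝ) ^ ((2 * M - 2 * σ - 1) * j)) := by
  -- Half of the Gaussian `exp (-γ t ^ 2)`, `t = |ξ| / 2 ^ j`, absorbs the powers of `t`; the other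
  -- half is the weight in the Cauchy–Schwarz inequality.
  set γ : ℝ := δ / (K ^ 2 + 1) with hγ
  have hγ0 : 0 < γ := by positivity
  obtain ⟨A, hA, hAt⟩ := exists_one_add_rpow_le_exp (p := σ + M) (c := γ / 2) (by linarith)
    (by positivity)
  set E : ℝ := C * K ^ σ * A
  have hE : 0 ≤ E := by positivity
  refine ⟨(∫⁻ ξ, v ξ ^ 2 * ENNReal.ofReal ((1 + ‖ξ‖) ^ (-2 * M))) *
    ENNReal.ofReal (E ^ 2 * (Real.pi / γ)),
    ENNReal.mul_ne_top hvM ENNReal.ofReal_ne_top, fun S j k hS hSK => ?_⟩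
  have h2j : (1 : ℝ) ≤ 2 ^ j := one_le_pow₀ (by norm_num)
  set q : ℝ := (2 : ℝ) ^ j
  have hq0 : 0 < q := by positivity
  set F : Plane → ℝ≥0∞ := fun ξ => v ξ * ENNReal.ofReal ((1 + ‖ξ‖) ^ (-M)) with hF
  set G : Plane → ℝ≥0∞ := fun ξ => ENNReal.ofReal
    (E * q ^ (M - σ) * Real.exp (-(γ / 2) * (‖ξ‖ / q) ^ 2)) with hG
  have hpt : ∀ ξ ∈ S, ‖Φ (frequencyMap j k ξ)‖ ≤
      (1 + ‖ξ‖) ^ (-M) * (E * q ^ (M - σ) * Real.exp (-(γ / 2) * (‖ξ‖ / q) ^ 2)) := by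
    intro ξ hξ
    set t : ℝ := ‖ξ‖ / q with ht
    have ht0 : 0 ≤ t := by positivity
    have h1 : 1 + ‖ξ‖ ≤ q * (1 + t) := by
      rw [mul_add, ht, mul_div_cancel₀ _ hq0.ne']
      linarith
    have h2 : t ^ σ * (1 + ‖ξ‖) ^ M ≤ q ^ M * (A * Real.exp (γ / 2 * t ^ 2)) := by
      calc t ^ σ * (1 + ‖ξ‖) ^ M ≤ (1 + t) ^ σ * (q * (1 + t)) ^ M := by
            gcongr
            linarith
        _ = q ^ M * (1 + t) ^ (σ + M) := by
            rw [Real.mul_rpow hq0.le (by positivity), Real.rpow_add (by positivity)]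
            ring
        _ ≤ _ := by
            gcongr
            exact hAt t ht0
    have h3 := norm_le_of_frequencyMap_bound hK hC hδ hσ.le hΦb j k (hSK ξ hξ)
    have hpos : 0 < (1 + ‖ξ‖) ^ M := by positivity
    rw [Real.rpow_neg (by positivity), inv_mul_eq_div, le_div_iff₀ hpos]
    calc ‖Φ (frequencyMap j k ξ)‖ * (1 + ‖ξ‖) ^ M
        ≤ C * K ^ σ * (q⁻¹) ^ σ * (t ^ σ * Real.exp (-γ * t ^ 2)) * (1 + ‖ξ‖) ^ M := by gcongr
      _ = C * K ^ σ * (q⁻¹) ^ σ * Real.exp (-γ * t ^ 2) * (t ^ σ * (1 + ‖ξ‖) ^ M) := by ring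
      _ ≤ C * K ^ σ * (q⁻¹) ^ σ * Real.exp (-γ * t ^ 2) *
          (q ^ M * (A * Real.exp (γ / 2 * t ^ 2))) := by gcongr
      _ = E * (q ^ M * (q⁻¹) ^ σ) * (Real.exp (-γ * t ^ 2) * Real.exp (γ / 2 * t ^ 2)) := by ring
      _ = E * q ^ (M - σ) * Real.exp (-(γ / 2) * t ^ 2) := by
          rw [← Real.exp_add, Real.inv_rpow hq0.le, ← div_eq_mul_inv, ← Real.rpow_sub hq0]
          congr 2
          ring
  have hle : ∫⁻ ξ in S, v ξ * ENNReal.ofReal ‖Φ (frequencyMap j k ξ)‖ ≤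
      ∫⁻ ξ in S, F ξ * G ξ := by
    refine setLIntegral_mono_ae' hS (.of_forall fun ξ hξ => ?_)
    rw [hF, hG, mul_assoc, ← ENNReal.ofReal_mul (by positivity)]
    gcongr
    exact hpt ξ hξ
  have hF2 : ∫⁻ ξ in S, F ξ ^ 2 ≤ ∫⁻ ξ, v ξ ^ 2 * ENNReal.ofReal ((1 + ‖ξ‖) ^ (-2 * M)) := by
    refine (setLIntegral_le_lintegral _ _).trans_eq ?_
    congr 1 with ξ
    rw [hF, mul_pow, ← ENNReal.ofReal_pow (by positivity), ← Real.rpow_natCast,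
      ← Real.rpow_mul (by positivity)]
    congr 3
    push_cast
    ring
  have hG2 : ∫⁻ ξ in S, G ξ ^ 2 ≤
      ENNReal.ofReal (E ^ 2 * (Real.pi / γ) * (q ^ (2 * (M - σ)) * q ^ 2)) := by
    have h1 : E ^ 2 * (Real.pi / γ) * (q ^ (2 * (M - σ)) * q ^ 2) =
        E ^ 2 * q ^ (2 * (M - σ)) * (Real.pi / (γ / q ^ 2)) := by
      field_simp
    rw [h1, ENNReal.ofReal_mul (by positivity), ← lintegral_exp_neg_mul_sq_norm (by positivity),
      ← lintegral_const_mul' _ _ ENNReal.ofReal_ne_top]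
    refine (setLIntegral_le_lintegral _ _).trans_eq ?_
    congr 1 with ξ
    rw [hG, ← ENNReal.ofReal_pow (by positivity), ← ENNReal.ofReal_mul (by positivity), mul_pow,
      mul_pow, ← Real.exp_nat_mul, ← Real.rpow_natCast (q ^ (M - σ)), ← Real.rpow_mul hq0.le]
    congr 3
    · congr 1
      push_cast
      ring
    · push_cast
      field_simp
  have hFm : AEMeasurable F (volume.restrict S) := by
    refine hv.restrict.mul (Measurable.aemeasurable ?_)
    fun_prop
  have hGm : AEMeasurable G (volume.restrict S) := by
    refine Measurable.aemeasurable ?_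
    fun_prop
  have hexp : wavepacketFactor j ^ 2 * (q ^ (2 * (M - σ)) * q ^ 2) =
      2 ^ ((2 * M - 2 * σ - 1) * j) := by
    have h8 : (8 : ℝ) ^ j = q ^ (3 : ℝ) := by
      rw [show (3 : ℝ) = ((3 : ℕ) : ℝ) by norm_num, Real.rpow_natCast, ← pow_mul, mul_comm, pow_mul]
      norm_num
    have hw : wavepacketFactor j ^ 2 = (q ^ (3 : ℝ))⁻¹ := by
      rw [← h8]
      exact eq_inv_of_mul_eq_one_left (wavepacketFactor_sq_mul j)
    have hq : q = 2 ^ (j : ℝ) := (Real.rpow_natCast 2 j).symm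
    rw [hw, ← Real.rpow_neg hq0.le, ← Real.rpow_natCast q 2, ← Real.rpow_add hq0,
      ← Real.rpow_add hq0, hq, ← Real.rpow_mul (by norm_num)]
    congr 1
    push_cast
    ring
  have hconst : ENNReal.ofReal (wavepacketFactor j) ^ 2 *
      ENNReal.ofReal (E ^ 2 * (Real.pi / γ) * (q ^ (2 * (M - σ)) * q ^ 2)) =
      ENNReal.ofReal (E ^ 2 * (Real.pi / γ)) *
        ENNReal.ofReal (2 ^ ((2 * M - 2 * σ - 1) * j)) := by
    rw [← hexp, ← ENNReal.ofReal_pow (wavepacketFactor_nonneg j),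
      ← ENNReal.ofReal_mul (by positivity), ← ENNReal.ofReal_mul (by positivity)]
    congr 1
    ring
  calc _ ≤ (ENNReal.ofReal (wavepacketFactor j) * ∫⁻ ξ in S, F ξ * G ξ) ^ 2 := by gcongr
    _ ≤ ENNReal.ofReal (wavepacketFactor j) ^ 2 *
        ((∫⁻ ξ in S, F ξ ^ 2) * ∫⁻ ξ in S, G ξ ^ 2) := by
        rw [mul_pow]
        gcongr
        exact sq_lintegral_mul_le _ hFm hGm
    _ ≤ ENNReal.ofReal (wavepacketFactor j) ^ 2 *
        ((∫⁻ ξ, v ξ ^ 2 * ENNReal.ofReal ((1 + ‖ξ‖) ^ (-2 * M))) *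
          ENNReal.ofReal (E ^ 2 * (Real.pi / γ) * (q ^ (2 * (M - σ)) * q ^ 2))) := by
        gcongr
    _ = _ := by
        rw [mul_left_comm, hconst, mul_assoc]

/-! ### Wavepackets away from their centre -/

theorem norm_iteratedFDeriv_wavepacket_le (φ : 𝓢(Plane, ℂ)) (j k m : ℕ) (a x : Plane) :
    ‖iteratedFDeriv ℝ m (wavepacket φ j k a) x‖ ≤
      (8 : ℝ) ^ j * (4 ^ j) ^ m * ‖iteratedFDeriv ℝ m φ (parabolicEquiv j k x - a)‖ := by
  have hsub : ContDiff ℝ m (fun y => φ (y - a)) := by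
    have := φ.smooth m
    fun_prop
  have h : ⇑(wavepacket φ j k a) = ((8 : ℝ) ^ ((j : ℝ) / 2)) •
      ((fun y => φ (y - a)) ∘ (parabolicEquiv j k : Plane →L[ℝ] Plane)) := by
    ext y
    rw [wavepacket_apply, ← parabolicEquiv_apply, Pi.smul_apply, Complex.real_smul]
    rfl
  rw [h, iteratedFDeriv_const_smul_apply
      (hsub.comp (parabolicEquiv j k : Plane →L[ℝ] Plane).contDiff).contDiffAt,
    ContinuousLinearMap.iteratedFDeriv_comp_right _ hsub x le_rfl, iteratedFDeriv_comp_sub,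
    norm_smul, Real.norm_of_nonneg (by positivity), mul_assoc]
  have h8 : (8 : ℝ) ^ ((j : ℝ) / 2) ≤ 8 ^ j := by
    rw [← Real.rpow_natCast]
    exact Real.rpow_le_rpow_of_exponent_le (by norm_num) (half_le_self (by positivity))
  gcongr
  refine (ContinuousMultilinearMap.norm_compContinuousLinearMap_le _ _).trans ?_
  rw [Finset.prod_const, Finset.card_fin, mul_comm]
  gcongr
  · exact norm_parabolicEquiv_le j k
  · exact le_rfl

/-- At a fixed positive distance from `x₀`, wavepackets centred near `x₀` decay, together with
their derivatives, faster than any power of the scale `2 ^ j`. -/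
theorem exists_norm_iteratedFDeriv_wavepacket_le (φ : 𝓢(Plane, ℂ)) (x₀ : Plane) {r : ℝ}
    (hr : 0 < r) (L : ℝ) (p n N : ℕ) :
    ∃ C : ℝ, 0 ≤ C ∧ ∀ (j k : ℕ) (a : Plane), ‖parabolicEquiv j k x₀ - a‖ ≤ L →
      ∀ m ≤ n, ∀ x : Plane, r ≤ ‖x - x₀‖ →
        ‖x‖ ^ p * ‖iteratedFDeriv ℝ m (wavepacket φ j k a) x‖ ≤ C * ((2 ^ j)⁻¹) ^ N := by
  -- The normalization and `n` derivatives cost at most `(2 ^ j) ^ (3 + 2 n)`, as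
  -- `8 ^ j = (2 ^ j) ^ 3` and `‖A_{j,k}‖ ≤ (2 ^ j) ^ 2`.
  set P : ℕ := 3 + 2 * n + N with hP
  obtain ⟨B, hB⟩ : ∃ B, B = 2 ^ (p + P) *
    (Finset.Iic (p + P, n)).sup (fun m => SchwartzMap.seminorm ℝ m.1 m.2) φ := ⟨_, rfl⟩
  have hB0 : 0 ≤ B := by
    rw [hB]
    positivity
  refine ⟨B * (1 + |L|) ^ (p + P) * (‖x₀‖ / r + 1) ^ p * (r ^ P)⁻¹, by positivity,
    fun j k a ha m hm x hx => ?_⟩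
  have hq1 : (1 : ℝ) ≤ 2 ^ j := one_le_pow₀ (by norm_num)
  have h8 : (8 : ℝ) ^ j = (2 ^ j) ^ 3 := by
    rw [← pow_mul, mul_comm, pow_mul]
    norm_num
  have h4 : (4 : ℝ) ^ j = (2 ^ j) ^ 2 := by
    rw [← pow_mul, mul_comm, pow_mul]
    norm_num
  have hW := norm_iteratedFDeriv_wavepacket_le φ j k m a x
  rw [h8, h4, ← pow_mul _ 2 m, ← pow_add] at hW
  set q : ℝ := 2 ^ j
  have hq0 : 0 < q := by positivity
  set y : Plane := parabolicEquiv j k x - a with hy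
  set d : ℝ := ‖x - x₀‖
  have hd0 : 0 < d := hr.trans_le hx
  have hdecay : (1 + ‖y‖) ^ (p + P) * ‖iteratedFDeriv ℝ m φ y‖ ≤ B := by
    rw [hB]
    exact SchwartzMap.one_add_le_sup_seminorm_apply (𝕜 := ℝ) (m := (p + P, n)) le_rfl hm φ y
  have hdist : q * d ≤ (1 + |L|) * (1 + ‖y‖) := by
    have h1 : ‖parabolicEquiv j k (x - x₀)‖ ≤ ‖y‖ + |L| := by
      have h2 : parabolicEquiv j k (x - x₀) = y - (parabolicEquiv j k x₀ - a) := by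
        rw [map_sub, hy]
        abel
      rw [h2]
      refine (norm_sub_le _ _).trans ?_
      gcongr
      exact ha.trans (le_abs_self L)
    have h3 := two_pow_mul_norm_le_norm_parabolicEquiv j k (x - x₀)
    nlinarith [abs_nonneg L, norm_nonneg y]
  have hxd : ‖x‖ ≤ (‖x₀‖ / r + 1) * d := by
    calc ‖x‖ = ‖x₀ + (x - x₀)‖ := by rw [add_sub_cancel]
      _ ≤ ‖x₀‖ / r * r + d := by
          rw [div_mul_cancel₀ _ hr.ne']
          exact norm_add_le _ _
      _ ≤ ‖x₀‖ / r * d + d := by gcongr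
      _ = (‖x₀‖ / r + 1) * d := by ring
  have hφ : ‖iteratedFDeriv ℝ m φ y‖ ≤ B * (1 + |L|) ^ (p + P) * ((q * d) ^ (p + P))⁻¹ := by
    rw [← div_eq_mul_inv, le_div_iff₀ (by positivity)]
    calc ‖iteratedFDeriv ℝ m φ y‖ * (q * d) ^ (p + P)
        ≤ ‖iteratedFDeriv ℝ m φ y‖ * ((1 + |L|) * (1 + ‖y‖)) ^ (p + P) := by gcongr
      _ = (1 + |L|) ^ (p + P) * ((1 + ‖y‖) ^ (p + P) * ‖iteratedFDeriv ℝ m φ y‖) := by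
          rw [mul_pow]
          ring
      _ ≤ (1 + |L|) ^ (p + P) * B := by gcongr
      _ = _ := mul_comm _ _
  have hqpow : q ^ (3 + 2 * m) * (q ^ (p + P))⁻¹ ≤ (q⁻¹) ^ N := by
    rw [← div_eq_mul_inv, div_le_iff₀ (by positivity), inv_pow, inv_mul_eq_div,
      le_div_iff₀ (by positivity), ← pow_add]
    exact pow_le_pow_right₀ hq1 (by omega)
  calc ‖x‖ ^ p * ‖iteratedFDeriv ℝ m (wavepacket φ j k a) x‖
      ≤ ((‖x₀‖ / r + 1) * d) ^ p * (q ^ (3 + 2 * m) *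
        (B * (1 + |L|) ^ (p + P) * ((q * d) ^ (p + P))⁻¹)) := by
        gcongr
        exact hW.trans (by gcongr)
    _ = B * (1 + |L|) ^ (p + P) * (‖x₀‖ / r + 1) ^ p * (d ^ P)⁻¹ *
        (q ^ (3 + 2 * m) * (q ^ (p + P))⁻¹) := by
        rw [mul_pow, mul_pow, pow_add d]
        field_simp
    _ ≤ B * (1 + |L|) ^ (p + P) * (‖x₀‖ / r + 1) ^ p * (r ^ P)⁻¹ * (q⁻¹) ^ N := by gcongr

theorem norm_iteratedFDeriv_conjSchwartz (ψ : 𝓢(Plane, ℂ)) (m : ℕ) (x : Plane) :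
    ‖iteratedFDeriv ℝ m (conjSchwartz ψ) x‖ = ‖iteratedFDeriv ℝ m ψ x‖ := by
  have h : ⇑(conjSchwartz ψ) = Complex.conjLIE ∘ ψ := by
    ext y
    simp [conjSchwartz_apply]
  rw [h, LinearIsometryEquiv.norm_iteratedFDeriv_comp_left]

theorem exists_seminorm_smulLeftCLM_wavepacket_le (φ : 𝓢(Plane, ℂ)) {x₀ : Plane} {r : ℝ}
    (hr : 0 < r) (L : ℝ) {χ : Plane → ℂ} (hχ : χ.HasTemperateGrowth)
    (hχb : ∀ i : ℕ, ∃ b : ℝ, ∀ x, ‖iteratedFDeriv ℝ i χ x‖ ≤ b)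
    (hχ0 : ∀ x ∈ Metric.ball x₀ r, χ x = 0) (p n N : ℕ) :
    ∃ C : ℝ, 0 ≤ C ∧ ∀ (j k : ℕ) (a : Plane), ‖parabolicEquiv j k x₀ - a‖ ≤ L →
      SchwartzMap.seminorm ℂ p n
        (SchwartzMap.smulLeftCLM ℂ χ (conjSchwartz (wavepacket φ j k a))) ≤
        C * ((2 ^ j)⁻¹) ^ N := by
  choose b hb using hχb
  have hb0 : ∀ i, 0 ≤ b i := fun i => (norm_nonneg _).trans (hb i 0)
  obtain ⟨C, hC, hCW⟩ := exists_norm_iteratedFDeriv_wavepacket_le φ x₀ hr L p n N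
  refine ⟨∑ i ∈ Finset.range (n + 1), (n.choose i : ℝ) * b i * C,
    Finset.sum_nonneg fun i _ => mul_nonneg (mul_nonneg (by positivity) (hb0 i)) hC,
    fun j k a ha => ?_⟩
  have hfun : ⇑(SchwartzMap.smulLeftCLM ℂ χ (conjSchwartz (wavepacket φ j k a))) =
      fun x => χ x * conjSchwartz (wavepacket φ j k a) x := by
    ext x
    rw [SchwartzMap.smulLeftCLM_apply_apply hχ, smul_eq_mul]
  refine SchwartzMap.seminorm_le_bound ℂ p n _ (mul_nonneg (Finset.sum_nonneg fun i _ =>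
    mul_nonneg (mul_nonneg (by positivity) (hb0 i)) hC) (by positivity)) fun x => ?_
  rw [hfun]
  rcases lt_or_ge ‖x - x₀‖ r with hx | hx
  · have hloc : (fun x => χ x * conjSchwartz (wavepacket φ j k a) x) =ᶠ[𝓝 x] fun _ => (0 : ℂ) := by
      filter_upwards [Metric.isOpen_ball.mem_nhds (mem_ball_iff_norm.2 hx)] with y hy
      rw [hχ0 y hy, zero_mul]
    rw [(hloc.iteratedFDeriv ℝ n).eq_of_nhds, iteratedFDeriv_fun_zero, Pi.zero_apply, norm_zero,
      mul_zero]
    exact mul_nonneg (Finset.sum_nonneg fun i _ =>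
      mul_nonneg (mul_nonneg (by positivity) (hb0 i)) hC) (by positivity)
  · have hleib := norm_iteratedFDeriv_mul_le (N := n) (hχ.1.of_le (by exact_mod_cast le_top))
      ((conjSchwartz (wavepacket φ j k a)).smooth n) x le_rfl
    calc ‖x‖ ^ p * _ ≤ ‖x‖ ^ p * _ := mul_le_mul_of_nonneg_left hleib (by positivity)
      _ ≤ ∑ i ∈ Finset.range (n + 1), (n.choose i : ℝ) * b i * (C * ((2 ^ j)⁻¹) ^ N) := by
          rw [Finset.mul_sum]
          refine Finset.sum_le_sum fun i _ => ?_
          rw [norm_iteratedFDeriv_conjSchwartz, mul_left_comm]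
          refine mul_le_mul (mul_le_mul_of_nonneg_left (hb i x) (by positivity))
            (hCW j k a ha (n - i) (Nat.sub_le _ _) x hx) (by positivity)
            (mul_nonneg (by positivity) (hb0 i))
      _ = _ := by
          rw [Finset.sum_mul]
          simp_rw [mul_assoc]

/-- A tempered distribution cut off to the complement of a neighbourhood of `x₀` pairs with
wavepackets centred near `x₀` to rapidly decreasing coefficients. -/
theorem exists_norm_apply_smulLeftCLM_wavepacket_le (f : 𝓢'(Plane, ℂ)) (φ : 𝓢(Plane, ℂ))
    {x₀ : Plane} {r : ℝ} (hr : 0 < r) (L : ℝ) {χ : Plane → ℂ} (hχ : χ.HasTemperateGrowth)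
    (hχb : ∀ i : ℕ, ∃ b : ℝ, ∀ x, ‖iteratedFDeriv ℝ i χ x‖ ≤ b)
    (hχ0 : ∀ x ∈ Metric.ball x₀ r, χ x = 0) (N : ℕ) :
    ∃ C : ℝ, 0 ≤ C ∧ ∀ (j k : ℕ) (a : Plane), ‖parabolicEquiv j k x₀ - a‖ ≤ L →
      ‖f (SchwartzMap.smulLeftCLM ℂ χ (conjSchwartz (wavepacket φ j k a)))‖ ≤
        C * ((2 ^ j)⁻¹) ^ N := by
  have hcont : Continuous fun g : 𝓢(Plane, ℂ) => ‖f g‖ :=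
    continuous_norm.comp (ContinuousLinearMap.continuous (M₁ := 𝓢(Plane, ℂ)) f)
  obtain ⟨s, c, -, hfs⟩ := Seminorm.bound_of_continuous (schwartz_withSeminorms ℂ Plane ℂ)
    ((normSeminorm ℂ ℂ).comp (f : 𝓢(Plane, ℂ) →ₗ[ℂ] ℂ)) hcont
  choose D hD hDW using fun i : ℕ × ℕ =>
    exists_seminorm_smulLeftCLM_wavepacket_le φ hr L hχ hχb hχ0 i.1 i.2 N
  refine ⟨c * ∑ i ∈ s, D i, mul_nonneg c.2 (Finset.sum_nonneg fun i _ => hD i),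
    fun j k a ha => ?_⟩
  set g := SchwartzMap.smulLeftCLM ℂ χ (conjSchwartz (wavepacket φ j k a))
  calc ‖f g‖ ≤ c * (s.sup (schwartzSeminormFamily ℂ Plane ℂ)) g := hfs g
    _ ≤ c * ((∑ i ∈ s, D i) * ((2 ^ j)⁻¹) ^ N) := by
        gcongr
        refine Seminorm.finset_sup_apply_le
          (mul_nonneg (Finset.sum_nonneg fun i _ => hD i) (by positivity)) fun i hi => ?_
        refine (hDW i j k a ha).trans ?_
        gcongr
        exact Finset.single_le_sum (fun i _ => hD i) hi
    _ = _ := by rw [mul_assoc]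

/-! ### Summation over the scales -/

theorem tsum_weight_ne_top {s c : ℝ} (h : 4 * s + c < 0) :
    ∑' j : ℕ, ENNReal.ofReal ((4 : ℝ) ^ (2 * (j : ℝ) * s)) *
      ENNReal.ofReal ((2 : ℝ) ^ (c * j)) ≠ ⊤ := by
  have hterm : ∀ j : ℕ, ENNReal.ofReal ((4 : ℝ) ^ (2 * (j : ℝ) * s)) *
      ENNReal.ofReal ((2 : ℝ) ^ (c * j)) = ENNReal.ofReal (((2 : ℝ) ^ (4 * s + c)) ^ j) := by
    intro j
    rw [← ENNReal.ofReal_mul (by positivity), show (4 : ℝ) = 2 ^ (2 : ℝ) by norm_num,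
      ← Real.rpow_mul (by norm_num), ← Real.rpow_add (by norm_num), ← Real.rpow_natCast,
      ← Real.rpow_mul (by norm_num)]
    congr 2
    norm_num
    ring
  simp_rw [hterm]
  rw [← ENNReal.ofReal_tsum_of_nonneg (fun j => by positivity)
    (summable_geometric_of_lt_one (by positivity)
      (Real.rpow_lt_one_of_one_lt_of_neg (by norm_num) h))]
  exact ENNReal.ofReal_ne_top

theorem sq_add_three_le (x y z : ℝ≥0∞) : (x + y + z) ^ 2 ≤ 3 * (x ^ 2 + y ^ 2 + z ^ 2) := by
  by_cases h : x = ⊤ ∨ y = ⊤ ∨ z = ⊤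
  · rcases h with rfl | rfl | rfl <;> simp
  · push Not at h
    obtain ⟨hx, hy, hz⟩ := h
    lift x to NNReal using hx
    lift y to NNReal using hy
    lift z to NNReal using hz
    norm_cast
    rw [← NNReal.coe_le_coe]
    push_cast
    nlinarith [sq_nonneg ((x : ℝ) - y), sq_nonneg ((y : ℝ) - z), sq_nonneg ((x : ℝ) - z)]

theorem aemeasurable_enorm_of_integrable_sq_mul {u : Plane → ℂ} {M : ℝ}
    (h : Integrable fun ξ => ‖u ξ‖ ^ 2 * (1 + ‖ξ‖) ^ (-2 * M)) :
    AEMeasurable fun ξ => ‖u ξ‖ₑ := by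
  have hm : AEMeasurable fun ξ : Plane =>
      Real.sqrt (‖u ξ‖ ^ 2 * (1 + ‖ξ‖) ^ (-2 * M) * (1 + ‖ξ‖) ^ (2 * M)) := by
    refine (h.aestronglyMeasurable.aemeasurable.mul (Measurable.aemeasurable ?_)).sqrt
    fun_prop
  convert! hm.ennreal_ofReal using 2 with ξ
  rw [mul_assoc, ← Real.rpow_add (by positivity), neg_mul, neg_add_cancel, Real.rpow_zero,
    mul_one, Real.sqrt_sq (norm_nonneg _), ofReal_norm]

theorem ofReal_sq_norm_mul (z : ℂ) {w : ℝ} (hw : 0 ≤ w) :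
    ‖z‖ₑ ^ 2 * ENNReal.ofReal w = ‖‖z‖ ^ 2 * w‖ₑ := by
  rw [← ofReal_norm, ← ENNReal.ofReal_pow (norm_nonneg _),
    ← ENNReal.ofReal_mul (by positivity), Real.enorm_of_nonneg (by positivity)]

/-- The pairing of a wavepacket with a distribution whose Fourier transform is a function is
controlled by an absolutely convergent integral on the frequency side, which is cut into the parts
inside and outside a set `S`. -/
theorem enorm_apply_wavepacket_le {T : 𝓢'(Plane, ℂ)} {u : Plane → ℂ} (hu : HasFourierFunction T u)
    (φ : 𝓢(Plane, ℂ)) {S : Set Plane} (hS : MeasurableSet S) (j k : ℕ) (a : Plane) :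
    ‖T (conjSchwartz (wavepacket φ j k a))‖ₑ ≤
      ENNReal.ofReal (wavepacketFactor j) * (∫⁻ ξ in S, ‖u ξ‖ₑ *
        ENNReal.ofReal ‖(𝓕 φ : 𝓢(Plane, ℂ)) (frequencyMap j k ξ)‖) +
      ENNReal.ofReal (wavepacketFactor j) * (∫⁻ ξ in Sᶜ, ‖u ξ‖ₑ *
        ENNReal.ofReal ‖(𝓕 φ : 𝓢(Plane, ℂ)) (frequencyMap j k ξ)‖) := by
  set g : 𝓢(Plane, ℂ) := 𝓕⁻ (conjSchwartz (wavepacket φ j k a)) with hg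
  have hT : T (conjSchwartz (wavepacket φ j k a)) = ∫ ξ, g ξ * u ξ := by
    rw [← (hu g).2, TemperedDistribution.fourier_apply, hg, FourierTransform.fourier_fourierInv_eq]
  rw [hT, ← mul_add, lintegral_add_compl _ hS, ← lintegral_const_mul' _ _ ENNReal.ofReal_ne_top]
  refine (enorm_integral_le_lintegral_enorm _).trans (lintegral_mono fun ξ => le_of_eq ?_)
  rw [enorm_mul, ← ofReal_norm (g ξ), hg, norm_fourierInv_conjSchwartz,
    norm_fourier_wavepacket, ENNReal.ofReal_mul (wavepacketFactor_nonneg j), mul_comm ‖u ξ‖ₑ,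
    mul_assoc]

theorem exists_norm_iteratedFDeriv_one_sub_le {η : Plane → ℂ} (hη : ContDiff ℝ ∞ η)
    (hc : HasCompactSupport η) (i : ℕ) :
    ∃ b : ℝ, ∀ x, ‖iteratedFDeriv ℝ i (fun y => 1 - η y) x‖ ≤ b := by
  obtain ⟨b, hb⟩ := (hη.continuous_iteratedFDeriv (m := i)
    (by exact_mod_cast le_top)).bounded_above_of_compact_support (hc.iteratedFDeriv i)
  refine ⟨1 + b, fun x => ?_⟩
  have hη' : ContDiffAt ℝ i η x := (hη.of_le (by exact_mod_cast le_top)).contDiffAt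
  rw [show (fun y => 1 - η y) = (fun _ => (1 : ℂ)) - η from rfl,
    iteratedFDeriv_sub_apply contDiffAt_const hη']
  refine (norm_sub_le _ _).trans (add_le_add ?_ (hb x))
  rcases Nat.eq_zero_or_pos i with rfl | hi
  · simp
  · rw [iteratedFDeriv_const_of_ne hi.ne']
    simp

/-- The weighted square sum of the coefficients is finite over the large scales, those at which the
grid angle is close to `2 π - θ₀` on the scale of the opening of the cone. -/
theorem exists_tsum_coeff_ne_top {s M σ : ℝ} (hs : 0 ≤ s) (hM : 0 ≤ M) (hσ : 2 < σ)
    (hσsM : 2 * s + 2 * M - 1 / 2 < σ) {φ : 𝓢(Plane, ℂ)} (hφ : WindowDecay φ σ)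
    {Λ : Submodule ℤ Plane} {L : ℝ} {x₀ : Plane} {θ₀ : ℝ} {k : ℕ → ℕ} {lam : ℕ → Plane}
    (hgrid : IsGridParameters Λ L x₀ θ₀ k lam) {f : 𝓢'(Plane, ℂ)}
    (hf : MemMicrolocalSobolev s M x₀ θ₀ f) :
    ∃ J : ℕ, ∑' n : ℕ, ENNReal.ofReal ((4 : ℝ) ^ (2 * ((n + J : ℕ) : ℝ) * s)) *
      ‖coeff f (wavepacket φ (n + J) (k (n + J)) (lam (n + J)))‖ₑ ^ 2 ≠ ⊤ := by
  obtain ⟨ε, η, u, hε, hη, hηc, hη1, hu, hucone, huM⟩ := hf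
  obtain ⟨C₀, δ, hδ, hC₀⟩ := hφ
  have hφb : ∀ ξ, ‖(𝓕 φ : 𝓢(Plane, ℂ)) ξ‖ ≤
      |C₀| * min 1 (|ξ 0| ^ σ) * Real.exp (-δ * ‖ξ‖ ^ 2) := fun ξ =>
    (hC₀ ξ).trans (by gcongr; exact le_abs_self C₀)
  have hv := aemeasurable_enorm_of_integrable_sq_mul huM
  set S := rotatedCone θ₀ ε
  have hS : MeasurableSet S := measurableSet_rotatedCone θ₀ ε
  have hvS : ∫⁻ ξ in S, ‖u ξ‖ₑ ^ 2 * ENNReal.ofReal (‖ξ‖ ^ (2 * s)) ≠ ⊤ := by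
    refine ne_of_eq_of_ne (lintegral_congr fun ξ => ?_) hucone.hasFiniteIntegral.ne
    exact ofReal_sq_norm_mul _ (by positivity)
  have hvM : ∫⁻ ξ, ‖u ξ‖ₑ ^ 2 * ENNReal.ofReal ((1 + ‖ξ‖) ^ (-2 * M)) ≠ ⊤ := by
    refine ne_of_eq_of_ne (lintegral_congr fun ξ => ?_) huM.hasFiniteIntegral.ne
    exact ofReal_sq_norm_mul _ (by positivity)
  -- As `2 < σ`, the lower bound on `σ` implies `s < σ`.
  have hX := exists_tsum_sq_lintegral_le hs (by linarith : s < σ) (abs_nonneg C₀) hδ hφb hv hvS k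
  obtain ⟨K, J₀, hK, hgeom⟩ := exists_gridRotation_bound (θ₀ := θ₀) hε
  obtain ⟨D, hD, hY⟩ := exists_sq_lintegral_le_of_gridRotation hM hK (abs_nonneg C₀) hδ
    (by linarith : 0 < σ) hφb hv hvM
  obtain ⟨r, hr, hball⟩ := Metric.eventually_nhds_iff_ball.1 hη1
  have hηt : η.HasTemperateGrowth := hηc.hasTemperateGrowth hη
  have hχt : (fun x => 1 - η x).HasTemperateGrowth :=
    (Function.HasTemperateGrowth.const (1 : ℂ)).sub hηt
  -- The far part only has to beat the weight `4 ^ (2 j s)` after squaring.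
  obtain ⟨N, hN⟩ := exists_nat_gt (2 * s)
  obtain ⟨E, hE, hZ⟩ := exists_norm_apply_smulLeftCLM_wavepacket_le f φ hr L hχt
    (exists_norm_iteratedFDeriv_one_sub_le hη hηc) (fun x hx => by rw [hball x hx, sub_self]) N
  set X : ℕ → ℝ≥0∞ := fun j => ENNReal.ofReal (wavepacketFactor j) * ∫⁻ ξ in S, ‖u ξ‖ₑ *
    ENNReal.ofReal ‖(𝓕 φ : 𝓢(Plane, ℂ)) (frequencyMap j (k j) ξ)‖
  set Y : ℕ → ℝ≥0∞ := fun j => ENNReal.ofReal (wavepacketFactor j) * ∫⁻ ξ in Sᶜ, ‖u ξ‖ₑ *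
    ENNReal.ofReal ‖(𝓕 φ : 𝓢(Plane, ℂ)) (frequencyMap j (k j) ξ)‖
  set w : ℕ → ℝ≥0∞ := fun j => ENNReal.ofReal ((4 : ℝ) ^ (2 * (j : ℝ) * s)) with hw
  -- The splitting `f = η f + (1 - η) f`.
  have hsplit : ∀ j, 1 ≤ j → ‖coeff f (wavepacket φ j (k j) (lam j))‖ₑ ≤
      X j + Y j + ENNReal.ofReal (E * ((2 ^ j)⁻¹) ^ N) := by
    intro j hj
    have hψ : conjSchwartz (wavepacket φ j (k j) (lam j)) =
        SchwartzMap.smulLeftCLM ℂ η (conjSchwartz (wavepacket φ j (k j) (lam j))) +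
        SchwartzMap.smulLeftCLM ℂ (fun x => 1 - η x)
          (conjSchwartz (wavepacket φ j (k j) (lam j))) := by
      ext x
      rw [add_apply, SchwartzMap.smulLeftCLM_apply_apply hηt,
        SchwartzMap.smulLeftCLM_apply_apply hχt, smul_eq_mul, smul_eq_mul]
      ring
    rw [coeff, hψ, map_add]
    refine (enorm_add_le _ _).trans (add_le_add ?_ ?_)
    · exact enorm_apply_wavepacket_le hu φ hS j (k j) (lam j)
    · rw [← ofReal_norm]
      exact ENNReal.ofReal_le_ofReal (hZ j (k j) (lam j) (hgrid.position j hj))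
  have hZ2 : ∀ j : ℕ, ENNReal.ofReal (E * ((2 ^ j)⁻¹) ^ N) ^ 2 =
      ENNReal.ofReal (E ^ 2) * ENNReal.ofReal ((2 : ℝ) ^ ((-(2 * N) : ℝ) * j)) := by
    intro j
    rw [← ENNReal.ofReal_pow (by positivity), ← ENNReal.ofReal_mul (by positivity), mul_pow,
      ← pow_mul, inv_pow, ← pow_mul, neg_mul, Real.rpow_neg (by norm_num)]
    congr 3
    rw [← Real.rpow_natCast]
    congr 1
    push_cast
    ring
  refine ⟨max J₀ 1, ?_⟩
  set J := max J₀ 1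
  set R : ℕ → ℝ≥0∞ := fun j => 3 * (w j * X j ^ 2 +
    (D * (w j * ENNReal.ofReal ((2 : ℝ) ^ ((2 * M - 2 * σ - 1) * j))) +
      ENNReal.ofReal (E ^ 2) * (w j * ENNReal.ofReal ((2 : ℝ) ^ ((-(2 * N) : ℝ) * j))))) with hR
  have hbound : ∀ n : ℕ, w (n + J) *
      ‖coeff f (wavepacket φ (n + J) (k (n + J)) (lam (n + J)))‖ₑ ^ 2 ≤ R (n + J) := by
    intro n
    have hj0 : J₀ ≤ n + J := (le_max_left _ _).trans (Nat.le_add_left _ _)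
    have hj1 : 1 ≤ n + J := (le_max_right _ _).trans (Nat.le_add_left _ _)
    generalize n + J = j at hj0 hj1 ⊢
    have hYj : Y j ^ 2 ≤ D * ENNReal.ofReal ((2 : ℝ) ^ ((2 * M - 2 * σ - 1) * j)) :=
      hY Sᶜ j (k j) hS.compl fun ξ hξ =>
        hgeom j (k j) hj0 (hgrid.angle_lower j hj1) (hgrid.angle_upper j hj1) ξ hξ
    calc w j * ‖coeff f (wavepacket φ j (k j) (lam j))‖ₑ ^ 2
        ≤ w j * (3 * (X j ^ 2 + Y j ^ 2 + ENNReal.ofReal (E * ((2 ^ j)⁻¹) ^ N) ^ 2)) := by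
          gcongr
          exact (pow_le_pow_left' (hsplit j hj1) 2).trans (sq_add_three_le _ _ _)
      _ ≤ w j * (3 * (X j ^ 2 + D * ENNReal.ofReal ((2 : ℝ) ^ ((2 * M - 2 * σ - 1) * j)) +
          ENNReal.ofReal (E ^ 2) * ENNReal.ofReal ((2 : ℝ) ^ ((-(2 * N) : ℝ) * j)))) := by
          rw [hZ2 j]
          gcongr
      _ = R j := by
          rw [hR]
          ring
  refine ne_top_of_le_ne_top ?_ ((ENNReal.tsum_le_tsum hbound).trans
    (ENNReal.tsum_comp_le_tsum_of_injective (add_left_injective J) R))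
  rw [hR, ENNReal.tsum_mul_left, ENNReal.tsum_add, ENNReal.tsum_add, ENNReal.tsum_mul_left,
    ENNReal.tsum_mul_left]
  exact ENNReal.mul_ne_top (by norm_num) (ENNReal.add_ne_top.2 ⟨hX, ENNReal.add_ne_top.2
    ⟨ENNReal.mul_ne_top hD (tsum_weight_ne_top (by linarith)),
      ENNReal.mul_ne_top ENNReal.ofReal_ne_top (tsum_weight_ne_top (by linarith))⟩⟩)

end Wavepacket

end

theorem mainTheorem5
    (s M σ : ℝ) (hs : 0 ≤ s) (hM : 0 ≤ M) (hσ : 2 < σ) (hσsM : 2 * s + 2 * M - 1 / 2 < σ)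
    (φ : 𝓢(Wavepacket.Plane, ℂ)) (hφ : Wavepacket.WindowDecay φ σ)
    (Λ : Submodule ℤ Wavepacket.Plane) [DiscreteTopology Λ] [IsZLattice ℝ Λ] (L : ℝ)
    (x₀ : Wavepacket.Plane) (θ₀ : ℝ) (hθ₀ : θ₀ ∈ Set.Ico 0 (2 * Real.pi))
    (k : ℕ → ℕ) (lam : ℕ → Wavepacket.Plane)
    (hgrid : Wavepacket.IsGridParameters Λ L x₀ θ₀ k lam)
    (f : 𝓢'(Wavepacket.Plane, ℂ)) (hf : Wavepacket.MemMicrolocalSobolev s M x₀ θ₀ f) :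
    Summable (fun j : {j : ℕ // 1 ≤ j} =>
      ‖Wavepacket.coeff f (Wavepacket.wavepacket φ j (k j) (lam j))‖ ^ 2 *
        (4 : ℝ) ^ (2 * (j : ℝ) * s)) ∧
    ∃ C : ℝ, ∀ j : ℕ, 1 ≤ j →
      ‖Wavepacket.coeff f (Wavepacket.wavepacket φ j (k j) (lam j))‖ ≤
        C * (4 : ℝ) ^ (-((j : ℝ) * s)) := by
  set h : ℕ → ℝ := fun j =>
    ‖Wavepacket.coeff f (Wavepacket.wavepacket φ j (k j) (lam j))‖ ^ 2 *
      (4 : ℝ) ^ (2 * (j : ℝ) * s) with hh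
  have hsum : Summable h := by
    obtain ⟨J, hJ⟩ := Wavepacket.exists_tsum_coeff_ne_top hs hM hσ hσsM hφ hgrid hf
    refine (summable_nat_add_iff J).1 ((ENNReal.summable_toReal hJ).congr fun n => ?_)
    rw [ENNReal.toReal_mul, ENNReal.toReal_ofReal (by positivity), ENNReal.toReal_pow,
      toReal_enorm, mul_comm]
  refine ⟨hsum.comp_injective Subtype.val_injective, √(∑' j, h j), fun j _ => ?_⟩
  rw [Real.rpow_neg (by norm_num), ← div_eq_mul_inv, le_div_iff₀ (by positivity)]
  refine Real.le_sqrt_of_sq_le (le_of_eq_of_le ?_ (hsum.le_tsum j fun i _ => by positivity))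
  rw [hh, mul_pow, ← Real.rpow_natCast (4 ^ _), ← Real.rpow_mul (by norm_num)]
  congr 2
  push_cast
  ring
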